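/- Identify $SU(2)$ with the group of unit quaternions, so that $\operatorname{tr} X = 2\operatorname{Re} X$, and let $(\alpha_1,\alpha_2)\in(0,\pi)^2$. For $0<\theta<\pi$ let $\mathbb S(\theta)=\{X\in SU(2) : \operatorname{tr}X=2\cos\theta\}$, which is a 2-sphere, and let $$R_2=\mathbb S(\alpha_1)\times\mathbb S(\alpha_2),\qquad H_2=\{(X_1,X_2,Y_1,Y_2)\in R_2\times R_2 : X_1X_2=Y_1Y_2\}.$$ The generator $\sigma_1$ of the braid group on two strands acts on $SU(2)^2$ by $(X_1,X_2)\sigma_1=(X_1X_2X_1^{-1},X_1)$. For $\beta=\sigma_1^{2\ell}$ with $\ell\in\mathbb Z$ (a braid whose closure is the $(2,2\ell)$-torus link), $\beta$ maps $R_2$ to itself. Let $$\Gamma_\beta=\{(X,X\beta) : X\in R_2\}\subset H_2,\qquad \Lambda_2=\{(X,X): X\in R_2\}\subset H_2 .$$ Let $\widehat H_2$ (the pillowcase), $\widehat\Gamma_\beta$ and $\widehat\Lambda_2$ be the quotients by simultaneous conjugation of the irreducible quadruples (those whose entries do not all commute) in $H_2$, $\Gamma_\beta$ and $\Lambda_2$.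 These are smooth manifolds of dimensions $2$, $1$, $1$; the tangent space of each quotient at the class of $p$ is the tangent space upstairs at $p$ modulo the tangent space to the conjugation orbit of $p$. Orientations: $R_2$ carries the product orientation, where both spheres $\mathbb S(\alpha_i)$ are oriented as the boundary of the ball in the space of imaginary quaternions; $\Lambda_2$ and $\Gamma_\beta$ are oriented by the projection to the first factor $R_2$; $H_2=f^{-1}(1)$, where $f=X_1X_2(Y_1Y_2)^{-1}$ on $R_2\times R_2$, and the quotients by conjugation are oriented by the base-fiber rule (base first), with the bases $\mathbf i,\mathbf j,\mathbf k$ of $\mathfrak{su}(2)$ and of the infinitesimal conjugation action. The local sign of a transversal intersection point of $\widehat\Lambda_2$ and $\widehat\Gamma_\beta$ is $+1$ if positive tangent vectors of $\widehat\Lambda_2$ and $\widehat\Gamma_\beta$, in this order, form a positive basis of the tangent plane of $\widehat H_2$, and $-1$ if they form a negative one. The algebraic intersection count of the two curves is the sum of these signs. **Proposition.** Let $\beta=\sigma_1^{2\ell}$ with $\ell\in\mathbb Z$, $\ell\neq 0$. For all $(\alpha_1,\alpha_2)\in(0,\pi)^2$ the curves $\widehat\Gamma_\beta$ and $\widehat\Lambda_2$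 intersect transversally in $\widehat H_2$, that is, at every point of $\widehat\Gamma_\beta\cap\widehat\Lambda_2$ their tangent lines span the tangent plane of $\widehat H_2$. Moreover there is $\varepsilon\in\{1,-1\}$ (which may depend on $\ell$, $\alpha_1$, $\alpha_2$) such that the local sign at every intersection point equals $\varepsilon$. -/

import Mathlib

open scoped Topology ContDiff

noncomputable section

namespace Pillowcase

/-! ### Tangent spaces and oriented frames -/

section Linear

variable {V W : Type*}

/-- Tangent space at `p` of a subset `S` of a normed space: the linear span of the velocities at
time `0` of smooth curves that lie in `S` and pass through `p` at time `0`. If `S` is an embedded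
submanifold near `p`, the velocities already form a vector space, its usual tangent space. -/
def tangentSpace [NormedAddCommGroup V] [NormedSpace ℝ V] (S : Set V) (p : V) : Submodule ℝ V :=
  Submodule.span ℝ {v | ∃ c : ℝ → V, ContDiffAt ℝ ∞ c 0 ∧ (∀ᶠ t in 𝓝 0, c t ∈ S) ∧
    c 0 = p ∧ deriv c 0 = v}

/-- An ordered basis of the subspace `T`. -/
def IsFrame [AddCommGroup V] [Module ℝ V] {k : ℕ} (T : Submodule ℝ V) (e : Fin k → V) : Prop :=
  LinearIndependent ℝ e ∧ Submodule.span ℝ (Set.range e) = T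

/-- The two frames are related by a matrix of positive determinant. -/
def SameOrientation [AddCommGroup V] [Module ℝ V] {k : ℕ} (e e' : Fin k → V) : Prop :=
  ∃ A : Matrix (Fin k) (Fin k) ℝ, 0 < A.det ∧ ∀ j, e' j = ∑ i, A i j • e i

/-- Product orientation. An orientation is given by the predicate which singles out the positively
oriented frames. A frame of the product is positive if it is equioriented with a positive frame of
the first factor followed by a positive frame of the second factor. -/
def ProdPositive [AddCommGroup V] [Module ℝ V] [AddCommGroup W] [Module ℝ W] {m n : ℕ}
    (P : (Fin m → V) → Prop) (Q : (Fin n → W) → Prop) (e : Fin (m + n) → V × W) : Prop :=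
  ∃ a b, P a ∧ Q b ∧
    SameOrientation (Fin.append (fun i => (a i, (0 : W))) (fun j => ((0 : V), b j))) e

end Linear

/-! ### Quadruples of unit quaternions, and the braid action -/

/-- `SU(2)`, identified with the group of unit quaternions. -/
abbrev SU2 : Type := unitary (Quaternion ℝ)

/-- Quadruples `((X₁, X₂), (Y₁, Y₂))`. -/
abbrev Quad : Type := (SU2 × SU2) × (SU2 × SU2)

/-- The vector space which contains all quadruples. -/
abbrev Amb : Type := (Quaternion ℝ × Quaternion ℝ) × (Quaternion ℝ × Quaternion ℝ)

/-- The inclusion of pairs of unit quaternions into pairs of quaternions. -/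
def emb₂ (X : SU2 × SU2) : Quaternion ℝ × Quaternion ℝ := (X.1, X.2)

/-- The inclusion of quadruples of unit quaternions into quadruples of quaternions. -/
def emb (p : Quad) : Amb := (emb₂ p.1, emb₂ p.2)

/-- The homeomorphism `(X₁, X₂) ↦ (X₁, X₂) σ₁ = (X₁ X₂ X₁⁻¹, X₁)` of `SU(2)²` that is induced by the
generator `σ₁` of the braid group on two strands (an infinite cyclic group). The homeomorphism
induced by `σ₁ ^ k` is the `k`-th power of this one, for every integer `k`. -/
def sigmaOne : Equiv.Perm (SU2 × SU2) where
  toFun X := (X.1 * X.2 * X.1⁻¹, X.1)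
  invFun X := (X.2, X.2⁻¹ * X.1 * X.2)
  left_inv X := by ext1 <;> simp [mul_assoc]
  right_inv X := by ext1 <;> simp [mul_assoc]

/-- The conjugacy class `𝕊(α)` of elements of trace `2 cos α`: the trace of a matrix in `SU(2)` is
twice the real part of the corresponding quaternion. -/
def conjClass (α : ℝ) : Set SU2 := {X | (X : Quaternion ℝ).re = Real.cos α}

/-- The space `R₂` of pairs `(X₁, X₂)` with `tr X₁ = 2 cos α₁` and `tr X₂ = 2 cos α₂`. -/
def R (α₁ α₂ : ℝ) : Set (SU2 × SU2) := conjClass α₁ ×ˢ conjClass α₂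

/-- The space `H₂` of quadruples in `R₂ × R₂` with `X₁ X₂ = Y₁ Y₂`. -/
def H (α₁ α₂ : ℝ) : Set Quad :=
  {p | p.1 ∈ R α₁ α₂ ∧ p.2 ∈ R α₁ α₂ ∧ p.1.1 * p.1.2 = p.2.1 * p.2.2}

/-- The diagonal `Λ₂`. -/
def Lam (α₁ α₂ : ℝ) : Set Quad := {p | p.1 ∈ R α₁ α₂ ∧ p.2 = p.1}

/-- The graph `Γ_β` of the homeomorphism `β`. -/
def Gam (α₁ α₂ : ℝ) (β : Equiv.Perm (SU2 × SU2)) : Set Quad :=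
  {p | p.1 ∈ R α₁ α₂ ∧ p.2 = β p.1}

/-- A quadruple is irreducible if its entries do not all commute with each other, that is, generate
a non-abelian subgroup of `SU(2)`. A subgroup of `SU(2)` acts reducibly on `ℂ²` exactly when it is
abelian. -/
def IsIrred (p : Quad) : Prop :=
  ¬ ∀ a ∈ ({p.1.1, p.1.2, p.2.1, p.2.2} : Set SU2),
    ∀ b ∈ ({p.1.1, p.1.2, p.2.1, p.2.2} : Set SU2), a * b = b * a

/-- Simultaneous conjugation by `g`. -/
def conj (g : SU2) (p : Quad) : Quad :=
  ((g * p.1.1 * g⁻¹, g * p.1.2 * g⁻¹), (g * p.2.1 * g⁻¹, g * p.2.2 * g⁻¹))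

/-- The irreducible quadruples of `H₂`. -/
abbrev HIrr (α₁ α₂ : ℝ) : Type := {p : Quad // p ∈ H α₁ α₂ ∧ IsIrred p}

/-- Two irreducible quadruples are equivalent if they are conjugate. -/
def conjSetoid (α₁ α₂ : ℝ) : Setoid (HIrr α₁ α₂) where
  r p q := ∃ g : SU2, conj g p.1 = q.1
  iseqv :=
    { refl := fun p => ⟨1, by simp [conj]⟩
      symm := by
        rintro p q ⟨g, h⟩
        exact ⟨g⁻¹, by rw [← h]; simp [conj, mul_assoc]⟩
      trans := by
        rintro p q r ⟨g, h⟩ ⟨k, h'⟩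
        exact ⟨k * g, by rw [← h', ← h]; simp [conj, mul_assoc]⟩ }

/-- The pillowcase `Ĥ₂`: irreducible quadruples of `H₂` up to conjugation. -/
def HHat (α₁ α₂ : ℝ) : Type := Quotient (conjSetoid α₁ α₂)

/-- The conjugacy class of an irreducible quadruple, as a point of the pillowcase. -/
def toHHat {α₁ α₂ : ℝ} (p : HIrr α₁ α₂) : HHat α₁ α₂ := Quotient.mk (conjSetoid α₁ α₂) p

/-- The curve `Λ̂₂` in the pillowcase. -/
def LamHat (α₁ α₂ : ℝ) : Set (HHat α₁ α₂) := {x | ∃ p, p.1 ∈ Lam α₁ α₂ ∧ toHHat p = x}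

/-- The curve `Γ̂_β` in the pillowcase. -/
def GamHat (α₁ α₂ : ℝ) (β : Equiv.Perm (SU2 × SU2)) : Set (HHat α₁ α₂) :=
  {x | ∃ p, p.1 ∈ Gam α₁ α₂ β ∧ toHHat p = x}

/-! ### Tangent spaces of the pillowcase and of the curves -/

/-- The basis `i, j, k` of the Lie algebra `su(2)`, the purely imaginary quaternions. -/
def ijk : Fin 3 → Quaternion ℝ := ![⟨0, 1, 0, 0⟩, ⟨0, 0, 1, 0⟩, ⟨0, 0, 0, 1⟩]

/-- The derivatives at `t = 0` of `exp (c t) p exp (-c t)` for `c = i, j, k`. For an irreducible `p`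
they form a basis of the tangent space to the orbit of `p` under conjugation. -/
def orbitFrame (p : Quad) (s : Fin 3) : Amb :=
  ((ijk s * p.1.1 - p.1.1 * ijk s, ijk s * p.1.2 - p.1.2 * ijk s),
    (ijk s * p.2.1 - p.2.1 * ijk s, ijk s * p.2.2 - p.2.2 * ijk s))

/-- The tangent space at `p` to the orbit of `p` under conjugation. -/
def orbitTangent (p : Quad) : Submodule ℝ Amb := Submodule.span ℝ (Set.range (orbitFrame p))

/-- The tangent space at `p` of a space of quadruples. -/
def tangentQuad (S : Set Quad) (p : Quad) : Submodule ℝ Amb := tangentSpace (emb '' S) (emb p)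

/-- The tangent space at the class of `p` of the quotient of `S` by conjugation, which is the tangent
space of `S` at `p` modulo the tangent space to the orbit. -/
def tangentHat (S : Set Quad) (p : Quad) : Submodule ℝ (Amb ⧸ orbitTangent p) :=
  (tangentQuad S p).map (orbitTangent p).mkQ

/-- At the point `x` of the pillowcase the tangent lines of `Λ̂₂` and `Γ̂_β` span the tangent space of
the pillowcase. -/
def TransverseAt {α₁ α₂ : ℝ} (β : Equiv.Perm (SU2 × SU2)) (x : HHat α₁ α₂) : Prop :=
  ∀ p : HIrr α₁ α₂, toHHat p = x →
    tangentHat (Lam α₁ α₂) p.1 ⊔ tangentHat (Gam α₁ α₂ β) p.1 = tangentHat (H α₁ α₂) p.1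

/-! ### Orientations -/

/-- The orientation of the sphere `𝕊(α)` by the outward normal: a frame `(a₀, a₁)` of the tangent
plane at `X` is positive if `(Im X, a₀, a₁)` is a positive basis of the imaginary quaternions. -/
def SpherePositive (α : ℝ) (X : SU2) (a : Fin 2 → Quaternion ℝ) : Prop :=
  IsFrame (tangentSpace ((fun Z : SU2 => (Z : Quaternion ℝ)) '' conjClass α) (X : Quaternion ℝ)) a ∧
    0 < Matrix.det !![(X : Quaternion ℝ).imI, (X : Quaternion ℝ).imJ, (X : Quaternion ℝ).imK;
      (a 0).imI, (a 0).imJ, (a 0).imK; (a 1).imI, (a 1).imJ, (a 1).imK]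

/-- The product orientation of `R₂ = 𝕊(α₁) × 𝕊(α₂)`. It does not change if the orientation of the
sphere is reversed in both factors. -/
def RPositive (α₁ α₂ : ℝ) (X : SU2 × SU2) :
    (Fin 4 → Quaternion ℝ × Quaternion ℝ) → Prop :=
  ProdPositive (m := 2) (n := 2) (SpherePositive α₁ X.1) (SpherePositive α₂ X.2)

/-- The product orientation of `R₂ × R₂`. -/
def RRPositive (α₁ α₂ : ℝ) (p : Quad) : (Fin 8 → Amb) → Prop :=
  ProdPositive (m := 4) (n := 4) (RPositive α₁ α₂ p.1) (RPositive α₁ α₂ p.2)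

/-- The orientation of `Λ₂` or `Γ_β` (the argument `S`) that is induced from `R₂` by the projection
onto `(X₁, X₂)`. -/
def GraphPositive (α₁ α₂ : ℝ) (S : Set Quad) (p : Quad) (e : Fin 4 → Amb) : Prop :=
  IsFrame (tangentQuad S p) e ∧ RPositive α₁ α₂ p.1 (fun i => (e i).1)

/-- The map `f (X₁, X₂, Y₁, Y₂) = X₁ X₂ (Y₁ Y₂)⁻¹`. On unit quaternions the inverse is the
conjugate. -/
def f (z : Amb) : Quaternion ℝ := z.1.1 * z.1.2 * star (z.2.1 * z.2.2)

/-- The orientation of `H₂ = f⁻¹(1)` by the base-fiber rule: a frame `e` of the tangent space of `H₂`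
is positive if `(w, e)` is a positive frame of `R₂ × R₂` for some triple `w` which `df` maps to a
positive basis of `su(2)`. -/
def HPositive (α₁ α₂ : ℝ) (p : Quad) (e : Fin 5 → Amb) : Prop :=
  IsFrame (tangentQuad (H α₁ α₂) p) e ∧
    ∃ w : Fin 3 → Amb, SameOrientation ijk (fun i => fderiv ℝ f (emb p) (w i)) ∧
      RRPositive α₁ α₂ p (Fin.append (m := 3) (n := 5) w e)

/-- The quotient orientation, by the base-fiber rule: a frame of the quotient is positive if it lifts
to a tuple which, followed by the orbit directions, is a positive frame upstairs. -/
def HatPositive {k : ℕ} (p : Quad) (P : (Fin (k + 3) → Amb) → Prop)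
    (u : Fin k → Amb ⧸ orbitTangent p) : Prop :=
  ∃ e : Fin k → Amb, (∀ i, (orbitTangent p).mkQ (e i) = u i) ∧ P (Fin.append e (orbitFrame p))

/-- The vectors `u` and `v` are positively oriented tangent vectors of `Λ̂₂` and `Γ̂_β` at the class of
`p`. -/
def PositiveTangents (α₁ α₂ : ℝ) (β : Equiv.Perm (SU2 × SU2)) (p : Quad)
    (u v : Amb ⧸ orbitTangent p) : Prop :=
  HatPositive (k := 1) p (GraphPositive α₁ α₂ (Lam α₁ α₂) p) ![u] ∧
    HatPositive (k := 1) p (GraphPositive α₁ α₂ (Gam α₁ α₂ β) p) ![v]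

open Classical in
/-- The contribution of the intersection point `x` to the intersection number of `Λ̂₂` and `Γ̂_β` in the
pillowcase: `1` if positive tangent vectors of `Λ̂₂` and `Γ̂_β`, in this order, form a positive frame of
the pillowcase, and `-1` if they form a negative one (`0` is the value where neither happens). -/
def localSign {α₁ α₂ : ℝ} (β : Equiv.Perm (SU2 × SU2)) (x : HHat α₁ α₂) : ℤ :=
  if ∃ p : HIrr α₁ α₂, toHHat p = x ∧ ∃ u v, PositiveTangents α₁ α₂ β p.1 u v ∧
      HatPositive (k := 2) p.1 (HPositive α₁ α₂ p.1) ![u, v] then 1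
  else if ∃ p : HIrr α₁ α₂, toHHat p = x ∧ ∃ u v, PositiveTangents α₁ α₂ β p.1 u v ∧
      HatPositive (k := 2) p.1 (HPositive α₁ α₂ p.1) ![v, u] then -1
  else 0

end Pillowcase

end

/-! Write `P = X₁ X₂`. The square of `σ₁` conjugates a pair by `P` and leaves `P` unchanged, so `σ₁
^ (2 ℓ)` is conjugation by `P ^ ℓ` (`sigmaOne_zpow_apply`). `Λ₂` and `Γ_β` are invariant under
simultaneous conjugation, so every representative of an intersection point lies in both: it is `((x,
y), (x, y))` with `x`, `y` non-commuting and `P ^ ℓ` commuting with both, whence `P ^ ℓ = s = ±1`.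

Let `c = x × y` (imaginary parts), `τ = Re P`, let `dμ` be the derivative of the product
(`mulDeriv`) and `O(a)` the infinitesimal conjugation by `a` (`orbitMap`). Since `P ^ ℓ = U_{ℓ-1}(τ)
P - U_{ℓ-2}(τ)` with Chebyshev polynomials, differentiating at the fixed point gives `dβ(v) = v + κ
Re(dμ v) O(P)`, where `κ = -ℓ / (1 - τ²)` (`hasDerivAt_braidMap`). So `Γ_β` has tangent vectors `(v,
dβ(v))`, and `Λ₂` is the case `κ = 0`. The kernel of `dμ` on the tangent space of `R₂` is the line
through `O(P)`, hence `H₂` has tangent vectors `(v, v + t O(P))` (`exists_smul_of_mulDeriv_eq_zero`,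
`tangentQuad_H`).

Orbit directions satisfy `Re dμ = 0`, while the vector `u = (x × c, 0)` has `Re dμ(u) = |c|² > 0`.
Modulo the orbit, the two curves therefore have the tangent vectors `(u, u)` and `(u, u + κ |c|²
O(P))`, which are independent because `κ ≠ 0`. This is transversality (`graphTangent_sup`).

For the sign, `u` followed by the orbit directions is a positive frame of `R₂`
(`sameOrientation_slice`), so both vectors are positive. Completing them by the orbit and by a
triple which `df` maps to a positive basis gives a frame of `R₂ × R₂` whose determinant is a
positive multiple of `-κ` (`exists_hasDet_levelFrame`, `sameOrientation_ratioDeriv_normalFrame`),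
thus of `ℓ`. The sign is that of `ℓ` at every intersection point. -/

noncomputable section

namespace Pillowcase

/-! ### Frames and orientations -/

section Frames

variable {V W : Type*} [AddCommGroup V] [Module ℝ V] [AddCommGroup W] [Module ℝ W] {k m n : ℕ}

/-- The second tuple is obtained from the first one by a matrix of determinant `d`. -/
def HasDet (e e' : Fin k → V) (d : ℝ) : Prop :=
  ∃ A : Matrix (Fin k) (Fin k) ℝ, A.det = d ∧ ∀ j, e' j = ∑ i, A i j • e i

theorem sameOrientation_iff_hasDet {e e' : Fin k → V} :
    SameOrientation e e' ↔ ∃ d, 0 < d ∧ HasDet e e' d := by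
  constructor
  · rintro ⟨A, hA, h⟩
    exact ⟨_, hA, A, rfl, h⟩
  · rintro ⟨_, hd, A, rfl, h⟩
    exact ⟨A, hd, h⟩

theorem HasDet.sameOrientation {e e' : Fin k → V} {d : ℝ} (h : HasDet e e' d) (hd : 0 < d) :
    SameOrientation e e' :=
  sameOrientation_iff_hasDet.2 ⟨d, hd, h⟩

theorem HasDet.trans {e e' e'' : Fin k → V} {c d : ℝ} (h : HasDet e e' c) (h' : HasDet e' e'' d) :
    HasDet e e'' (c * d) := by
  obtain ⟨A, rfl, hA⟩ := h
  obtain ⟨B, rfl, hB⟩ := h'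
  refine ⟨A * B, Matrix.det_mul _ _, fun j => ?_⟩
  simp only [hB, hA, Finset.smul_sum, Matrix.mul_apply, Finset.sum_smul, smul_smul]
  rw [Finset.sum_comm]
  simp only [mul_comm]

theorem HasDet.refl (e : Fin k → V) : HasDet e e 1 :=
  ⟨1, Matrix.det_one, fun j => by simp [Matrix.one_apply]⟩

theorem HasDet.symm {e e' : Fin k → V} {d : ℝ} (h : HasDet e e' d) (hd : d ≠ 0) :
    HasDet e' e d⁻¹ := by
  obtain ⟨A, rfl, hA⟩ := h
  refine ⟨A⁻¹, by rw [Matrix.det_nonsing_inv, Ring.inverse_eq_inv'], fun j => ?_⟩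
  have key : A * A⁻¹ = 1 := Matrix.mul_nonsing_inv A (isUnit_iff_ne_zero.2 hd)
  calc e j = ∑ i, (A * A⁻¹) i j • e i := by rw [key]; simp [Matrix.one_apply]
    _ = ∑ i, A⁻¹ i j • e' i := by
      simp only [hA, Finset.smul_sum, Matrix.mul_apply, Finset.sum_smul, smul_smul]
      rw [Finset.sum_comm]
      simp only [mul_comm]

theorem SameOrientation.trans {e e' e'' : Fin k → V} (h : SameOrientation e e')
    (h' : SameOrientation e' e'') : SameOrientation e e'' := by
  obtain ⟨c, hc, h⟩ := sameOrientation_iff_hasDet.1 h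
  obtain ⟨d, hd, h'⟩ := sameOrientation_iff_hasDet.1 h'
  exact (h.trans h').sameOrientation (mul_pos hc hd)

theorem SameOrientation.symm {e e' : Fin k → V} (h : SameOrientation e e') :
    SameOrientation e' e := by
  obtain ⟨c, hc, h⟩ := sameOrientation_iff_hasDet.1 h
  exact (h.symm hc.ne').sameOrientation (inv_pos.2 hc)

theorem SameOrientation.refl (e : Fin k → V) : SameOrientation e e :=
  (HasDet.refl e).sameOrientation one_pos

/-- Independence makes the coefficients unique. This lets an explicitly computed determinant be
compared with one known only to be positive. -/
theorem HasDet.unique {e e' : Fin k → V} {c d : ℝ} (he : LinearIndependent ℝ e)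
    (h : HasDet e e' c) (h' : HasDet e e' d) : c = d := by
  obtain ⟨A, rfl, hA⟩ := h
  obtain ⟨B, rfl, hB⟩ := h'
  congr 1
  ext i j
  have h0 : ∑ i, (A i j - B i j) • e i = 0 := by
    simp only [sub_smul, Finset.sum_sub_distrib, ← hA, ← hB, sub_self]
  exact sub_eq_zero.1 (Fintype.linearIndependent_iff.1 he _ h0 i)

theorem HasDet.map (φ : V →ₗ[ℝ] W) {e e' : Fin k → V} {d : ℝ} (h : HasDet e e' d) :
    HasDet (fun i => φ (e i)) (fun i => φ (e' i)) d := by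
  obtain ⟨A, rfl, hA⟩ := h
  exact ⟨A, rfl, fun j => by simp [hA]⟩

theorem SameOrientation.map (φ : V →ₗ[ℝ] W) {e e' : Fin k → V} (h : SameOrientation e e') :
    SameOrientation (fun i => φ (e i)) (fun i => φ (e' i)) := by
  obtain ⟨c, hc, h⟩ := sameOrientation_iff_hasDet.1 h
  exact (h.map φ).sameOrientation hc

theorem HasDet.span_le {e e' : Fin k → V} {d : ℝ} (h : HasDet e e' d) :
    Submodule.span ℝ (Set.range e') ≤ Submodule.span ℝ (Set.range e) := by
  obtain ⟨A, rfl, hA⟩ := h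
  rw [Submodule.span_le]
  rintro _ ⟨j, rfl⟩
  rw [hA]
  exact Submodule.sum_mem _ fun i _ => Submodule.smul_mem _ _ (Submodule.subset_span ⟨i, rfl⟩)

theorem HasDet.span_eq {e e' : Fin k → V} {d : ℝ} (h : HasDet e e' d) (hd : d ≠ 0) :
    Submodule.span ℝ (Set.range e') = Submodule.span ℝ (Set.range e) :=
  le_antisymm h.span_le (h.symm hd).span_le

theorem HasDet.isFrame {T : Submodule ℝ V} {e e' : Fin k → V} {d : ℝ} (h : HasDet e e' d)
    (hd : d ≠ 0) (he : IsFrame T e) : IsFrame T e' := by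
  refine ⟨?_, (h.span_eq hd).trans he.2⟩
  rw [linearIndependent_iff_card_le_finrank_span, Set.finrank, h.span_eq hd]
  exact linearIndependent_iff_card_le_finrank_span.1 he.1

theorem SameOrientation.isFrame {T : Submodule ℝ V} {e e' : Fin k → V}
    (h : SameOrientation e e') (he : IsFrame T e) : IsFrame T e' := by
  obtain ⟨c, hc, h⟩ := sameOrientation_iff_hasDet.1 h
  exact h.isFrame hc.ne' he

theorem IsFrame.mem {T : Submodule ℝ V} {e : Fin k → V} (he : IsFrame T e) (i : Fin k) :
    e i ∈ T := he.2 ▸ Submodule.subset_span ⟨i, rfl⟩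

theorem exists_coeff {e : Fin k → V} {v : V} (hv : v ∈ Submodule.span ℝ (Set.range e)) :
    ∃ c : Fin k → ℝ, v = ∑ i, c i • e i := by
  obtain ⟨c, hc⟩ := (Submodule.mem_span_range_iff_exists_fun ℝ).1 hv
  exact ⟨c, hc.symm⟩

theorem sum_mem_span (e : Fin k → V) (c : Fin k → ℝ) :
    ∑ i, c i • e i ∈ Submodule.span ℝ (Set.range e) :=
  Submodule.sum_mem _ fun i _ => Submodule.smul_mem _ _ (Submodule.subset_span ⟨i, rfl⟩)

/-- Two frames are related by a matrix as soon as the second one lies in the span of the first. -/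
theorem exists_hasDet {e e' : Fin k → V}
    (h : ∀ j, e' j ∈ Submodule.span ℝ (Set.range e)) : ∃ d, HasDet e e' d := by
  choose A hA using fun j => exists_coeff (h j)
  exact ⟨_, (Matrix.of fun i j => A j i), rfl, hA⟩

/-- Block determinants live on sum types; reindexing by `finSumFinEquiv` carries them to joined
tuples. -/
theorem hasDet_append_fromBlocks {a a' : Fin m → V} {b b' : Fin n → V}
    (C : Matrix (Fin m) (Fin m) ℝ) (B : Matrix (Fin m) (Fin n) ℝ) (D : Matrix (Fin n) (Fin m) ℝ)
    (E : Matrix (Fin n) (Fin n) ℝ)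
    (ha : ∀ j, a' j = ∑ i, C i j • a i + ∑ i, D i j • b i)
    (hb : ∀ j, b' j = ∑ i, B i j • a i + ∑ i, E i j • b i) :
    HasDet (Fin.append a b) (Fin.append a' b') (Matrix.fromBlocks C B D E).det := by
  refine ⟨(Matrix.fromBlocks C B D E).submatrix finSumFinEquiv.symm finSumFinEquiv.symm,
    Matrix.det_submatrix_equiv_self _ _, fun j => ?_⟩
  rw [Fin.sum_univ_add]
  refine Fin.addCases (fun j => ?_) (fun j => ?_) j
  · simp [ha]
  · simp [hb]

/-- If the first parts agree up to `C` modulo the second parts, the determinant of the joined frames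
is the product. -/
theorem HasDet.append_of_mod {a a' : Fin m → V} {b b' : Fin n → V} {d : ℝ}
    (C : Matrix (Fin m) (Fin m) ℝ)
    (h : ∀ j, a' j - ∑ i, C i j • a i ∈ Submodule.span ℝ (Set.range b)) (hb : HasDet b b' d) :
    HasDet (Fin.append a b) (Fin.append a' b') (C.det * d) := by
  obtain ⟨E, rfl, hE⟩ := hb
  choose D hD using fun j => exists_coeff (h j)
  rw [← Matrix.det_fromBlocks_zero₁₂ C (Matrix.of fun i j => D j i) E]
  refine hasDet_append_fromBlocks _ _ _ _ (fun j => ?_) fun j => ?_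
  · rw [← sub_eq_iff_eq_add', hD]
    rfl
  · simp [hE]

theorem SameOrientation.append_of_mod {a a' : Fin m → V} {b b' : Fin n → V}
    (C : Matrix (Fin m) (Fin m) ℝ) (hC : 0 < C.det)
    (h : ∀ j, a' j - ∑ i, C i j • a i ∈ Submodule.span ℝ (Set.range b))
    (hb : SameOrientation b b') : SameOrientation (Fin.append a b) (Fin.append a' b') := by
  obtain ⟨d, hd, hb⟩ := sameOrientation_iff_hasDet.1 hb
  exact (HasDet.append_of_mod C h hb).sameOrientation (mul_pos hC hd)

/-- The determinant of a frame which begins with fixed vectors can be computed modulo these. -/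
theorem HasDet.append_left_of_mod {a : Fin m → V} {b b' : Fin n → V}
    (E : Matrix (Fin n) (Fin n) ℝ)
    (h : ∀ j, b' j - ∑ i, E i j • b i ∈ Submodule.span ℝ (Set.range a)) :
    HasDet (Fin.append a b) (Fin.append a b') E.det := by
  choose D hD using fun j => exists_coeff (h j)
  have := Matrix.det_fromBlocks_zero₂₁ (1 : Matrix (Fin m) (Fin m) ℝ) (Matrix.of fun i j => D j i) E
  rw [Matrix.det_one, one_mul] at this
  rw [← this]
  refine hasDet_append_fromBlocks _ _ _ _ (fun j => ?_) fun j => ?_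
  · simp [Matrix.one_apply]
  · rw [← sub_eq_iff_eq_add, hD]
    rfl

/-- A single vector in front of a fixed frame: positivity determines it modulo the frame up to a
positive factor. -/
theorem exists_pos_of_sameOrientation_append {a a' : V} {b : Fin n → V}
    (hli : LinearIndependent ℝ (Fin.append ![a] b))
    (h : SameOrientation (Fin.append ![a] b) (Fin.append ![a'] b)) :
    ∃ c : ℝ, 0 < c ∧ a' - c • a ∈ Submodule.span ℝ (Set.range b) := by
  have hspan : a' ∈ Submodule.span ℝ (Set.range (Fin.append ![a] b)) := by
    obtain ⟨A, -, hA⟩ := h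
    have := hA (Fin.castAdd n 0)
    rw [Fin.append_left] at this
    rw [show a' = ![a'] 0 from rfl, this]
    exact sum_mem_span _ _
  obtain ⟨c, hc⟩ := exists_coeff hspan
  rw [Fin.sum_univ_add] at hc
  simp only [Fin.append_left, Fin.append_right, Finset.univ_unique, Finset.sum_singleton,
    Matrix.cons_val_fin_one] at hc
  have hmem : a' - c (Fin.castAdd n default) • a ∈ Submodule.span ℝ (Set.range b) := by
    rw [hc, add_sub_cancel_left]
    exact sum_mem_span b _
  refine ⟨_, ?_, hmem⟩
  obtain ⟨d, hd, h⟩ := sameOrientation_iff_hasDet.1 h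
  have h2 : HasDet (Fin.append ![a] b) (Fin.append ![a'] b)
      ((Matrix.of fun _ _ : Fin 1 => c (Fin.castAdd n default)).det * 1) :=
    HasDet.append_of_mod _ (fun j => by simpa using hmem) (HasDet.refl b)
  have := HasDet.unique hli h h2
  simp only [Matrix.det_unique, Matrix.of_apply, mul_one] at this
  rw [← this]
  exact hd

theorem IsFrame.prod {T : Submodule ℝ V} {T' : Submodule ℝ W} {a : Fin m → V} {b : Fin n → W}
    (ha : IsFrame T a) (hb : IsFrame T' b) :
    IsFrame (T.prod T') (Fin.append (fun i => (a i, (0 : W))) (fun j => ((0 : V), b j))) := by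
  have h : Fin.append (fun i => (a i, (0 : W))) (fun j => ((0 : V), b j)) =
      Sum.elim (LinearMap.inl ℝ V W ∘ a) (LinearMap.inr ℝ V W ∘ b) ∘ finSumFinEquiv.symm := by
    funext i
    refine Fin.addCases (fun j => ?_) (fun j => ?_) i <;> simp
  constructor
  · rw [h, linearIndependent_equiv]
    exact linearIndependent_inl_union_inr' ha.1 hb.1
  · rw [h, Set.range_comp, finSumFinEquiv.symm.surjective.range_eq, Set.image_univ,
      Set.Sum.elim_range, Set.range_comp, Set.range_comp, LinearMap.span_inl_union_inr, ha.2, hb.2]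

theorem SameOrientation.prod {a a' : Fin m → V} {b b' : Fin n → W}
    (ha : SameOrientation a a') (hb : SameOrientation b b') :
    SameOrientation (Fin.append (fun i => (a i, (0 : W))) (fun j => ((0 : V), b j)))
      (Fin.append (fun i => (a' i, (0 : W))) (fun j => ((0 : V), b' j))) := by
  obtain ⟨C, hC, h⟩ := ha.map (LinearMap.inl ℝ V W)
  refine SameOrientation.append_of_mod C hC (fun j => ?_) (hb.map (LinearMap.inr ℝ V W))
  have := h j
  simp only [LinearMap.inl_apply] at this
  rw [this, sub_self]
  exact zero_mem _

/-- `P` is the orientation of the subspace `T` in which the frame `e` is positive. -/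
def Orients (T : Submodule ℝ V) (e : Fin k → V) (P : (Fin k → V) → Prop) : Prop :=
  IsFrame T e ∧ ∀ e', P e' ↔ SameOrientation e e'

/-- A block-diagonal change of frame with positive blocks has positive determinant, so the product
orientation is tested by one frame. -/
theorem Orients.prod {T : Submodule ℝ V} {T' : Submodule ℝ W} {a : Fin m → V} {b : Fin n → W}
    {P : (Fin m → V) → Prop} {Q : (Fin n → W) → Prop} (hP : Orients T a P) (hQ : Orients T' b Q) :
    Orients (T.prod T') (Fin.append (fun i => (a i, (0 : W))) (fun j => ((0 : V), b j)))
      (ProdPositive P Q) := by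
  refine ⟨hP.1.prod hQ.1, fun e => ⟨?_, fun h => ?_⟩⟩
  · rintro ⟨a', b', ha, hb, h⟩
    exact (((hP.2 _).1 ha).prod ((hQ.2 _).1 hb)).trans h
  · exact ⟨a, b, (hP.2 _).2 (.refl _), (hQ.2 _).2 (.refl _), h⟩

end Frames

/-! ### Quaternion algebra -/

section Algebra

/-- Scalar product of the imaginary parts. -/
def dot (a b : Quaternion ℝ) : ℝ := a.imI * b.imI + a.imJ * b.imJ + a.imK * b.imK

theorem dot_zero (a : Quaternion ℝ) : dot a 0 = 0 := by
  change a.imI * 0 + a.imJ * 0 + a.imK * 0 = 0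
  ring

/-- Cross product of the imaginary parts. -/
def cross (a b : Quaternion ℝ) : Quaternion ℝ :=
  ⟨0, a.imJ * b.imK - a.imK * b.imJ, a.imK * b.imI - a.imI * b.imK,
    a.imI * b.imJ - a.imJ * b.imI⟩

/-- Determinant of the imaginary parts. -/
def triple (a b c : Quaternion ℝ) : ℝ :=
  Matrix.det !![a.imI, a.imJ, a.imK; b.imI, b.imJ, b.imK; c.imI, c.imJ, c.imK]

theorem triple_eq (a b c : Quaternion ℝ) : triple a b c = dot a (cross b c) := by
  simp only [triple, Matrix.det_fin_three, dot, cross]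
  simp
  ring

@[simp] theorem cross_re (a b : Quaternion ℝ) : (cross a b).re = 0 := rfl
@[simp] theorem cross_imI (a b : Quaternion ℝ) :
    (cross a b).imI = a.imJ * b.imK - a.imK * b.imJ := rfl
@[simp] theorem cross_imJ (a b : Quaternion ℝ) :
    (cross a b).imJ = a.imK * b.imI - a.imI * b.imK := rfl
@[simp] theorem cross_imK (a b : Quaternion ℝ) :
    (cross a b).imK = a.imI * b.imJ - a.imJ * b.imI := rfl

theorem dot_self_nonneg (a : Quaternion ℝ) : 0 ≤ dot a a := by
  unfold dot; nlinarith [sq_nonneg a.imI, sq_nonneg a.imJ, sq_nonneg a.imK]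

theorem eq_zero_of_dot_self {a : Quaternion ℝ} (hr : a.re = 0) (h : dot a a = 0) : a = 0 := by
  unfold dot at h
  have h1 : a.imI = 0 := by nlinarith [sq_nonneg a.imI, sq_nonneg a.imJ, sq_nonneg a.imK]
  have h2 : a.imJ = 0 := by nlinarith [sq_nonneg a.imI, sq_nonneg a.imJ, sq_nonneg a.imK]
  have h3 : a.imK = 0 := by nlinarith [sq_nonneg a.imI, sq_nonneg a.imJ, sq_nonneg a.imK]
  exact Quaternion.ext _ _ hr h1 h2 h3

/-- The imaginary quaternions perpendicular to `x`. -/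
def sphereTangent (x : Quaternion ℝ) : Submodule ℝ (Quaternion ℝ) where
  carrier := {v | v.re = 0 ∧ dot x v = 0}
  zero_mem' := ⟨rfl, dot_zero x⟩
  add_mem' := by
    rintro a b ⟨h1, h2⟩ ⟨h3, h4⟩
    simp only [dot, Set.mem_ofPred_eq, Quaternion.re_add, Quaternion.imI_add, Quaternion.imJ_add,
      Quaternion.imK_add] at *
    constructor <;> linarith
  smul_mem' := by
    rintro r a ⟨h1, h2⟩
    simp only [dot, Set.mem_ofPred_eq, Quaternion.re_smul, Quaternion.imI_smul, Quaternion.imJ_smul,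
      Quaternion.imK_smul, smul_eq_mul] at *
    exact ⟨by rw [h1, mul_zero], by linear_combination r * h2⟩

theorem cross_mem_sphereTangent (x y : Quaternion ℝ) : cross x y ∈ sphereTangent x :=
  ⟨rfl, by simp only [dot, cross_imI, cross_imJ, cross_imK]; ring⟩

theorem cross_mem_sphereTangent_right (x y : Quaternion ℝ) : cross x y ∈ sphereTangent y :=
  ⟨rfl, by simp only [dot, cross_imI, cross_imJ, cross_imK]; ring⟩

theorem commutator_mem_sphereTangent (a x : Quaternion ℝ) : a * x - x * a ∈ sphereTangent x := by
  constructor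
  · simp; ring
  · simp [dot]; ring

theorem dot_cross_self {x d : Quaternion ℝ} (hd : d ∈ sphereTangent x) :
    dot (cross x d) (cross x d) = dot x x * dot d d := by
  obtain ⟨-, h⟩ := hd
  have : dot (cross x d) (cross x d) = dot x x * dot d d - dot x d ^ 2 := by
    simp only [dot, cross_imI, cross_imJ, cross_imK]; ring
  rw [this, h]; ring

theorem sphereTangent_isFrame {x d : Quaternion ℝ} (hd : d ∈ sphereTangent x)
    (hx : 0 < dot x x) (hd0 : 0 < dot d d) : IsFrame (sphereTangent x) ![d, cross x d] := by
  have hdx := hd.2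
  have hcd := dot_cross_self hd
  constructor
  · rw [LinearIndependent.pair_iff]
    intro s t h
    have e1 : dot d (s • d + t • cross x d) = s * dot d d := by
      simp [dot]; ring
    have e2 : dot (cross x d) (s • d + t • cross x d) = t * dot (cross x d) (cross x d) := by
      simp [dot]; ring
    rw [h] at e1 e2
    rw [hcd] at e2
    rw [dot_zero] at e1 e2
    constructor
    · rcases mul_eq_zero.1 e1.symm with h | h
      · exact h
      · exact absurd h hd0.ne'
    · rcases mul_eq_zero.1 e2.symm with h | h
      · exact h
      · exact absurd h (mul_pos hx hd0).ne'
  · apply le_antisymm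
    · rw [Submodule.span_le]
      rintro _ ⟨i, rfl⟩
      fin_cases i
      · exact hd
      · exact cross_mem_sphereTangent _ _
    · intro v hv
      obtain ⟨hv1, hv2⟩ := hv
      rw [Matrix.range_cons, Matrix.range_cons, Matrix.range_empty, Set.union_empty,
        Set.singleton_union, Submodule.mem_span_pair]
      refine ⟨dot v d / dot d d, dot v (cross x d) / (dot x x * dot d d), ?_⟩
      have hdr := hd.1
      -- Expansion of `v` in the orthogonal basis `d`, `x × d`, with denominators cleared; it holds
      -- modulo the two relations `x · d = 0` and `x · v = 0`.
      have key : (dot x x * dot d d) • v = (dot x x * dot v d) • d + dot v (cross x d) • cross x d := by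
        have hh : dot x d = 0 := hdx
        have hh' : dot x v = 0 := hv2
        simp only [dot] at hh hh'
        ext
        · simp [hv1, hdr]
        all_goals simp only [dot, Quaternion.imI_smul, Quaternion.imJ_smul, Quaternion.imK_smul,
            Quaternion.imI_add, Quaternion.imJ_add, Quaternion.imK_add, cross_imI, cross_imJ,
            cross_imK, smul_eq_mul]
        · linear_combination hh' * ((d.imI * d.imI + d.imJ * d.imJ + d.imK * d.imK) * x.imI
            - (x.imI * d.imI + x.imJ * d.imJ + x.imK * d.imK) * d.imI)
            + hh * ((x.imI * d.imI + x.imJ * d.imJ + x.imK * d.imK) * v.imI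
            - (v.imI * d.imI + v.imJ * d.imJ + v.imK * d.imK) * x.imI)
        · linear_combination hh' * ((d.imI * d.imI + d.imJ * d.imJ + d.imK * d.imK) * x.imJ
            - (x.imI * d.imI + x.imJ * d.imJ + x.imK * d.imK) * d.imJ)
            + hh * ((x.imI * d.imI + x.imJ * d.imJ + x.imK * d.imK) * v.imJ
            - (v.imI * d.imI + v.imJ * d.imJ + v.imK * d.imK) * x.imJ)
        · linear_combination hh' * ((d.imI * d.imI + d.imJ * d.imJ + d.imK * d.imK) * x.imK
            - (x.imI * d.imI + x.imJ * d.imJ + x.imK * d.imK) * d.imK)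
            + hh * ((x.imI * d.imI + x.imJ * d.imJ + x.imK * d.imK) * v.imK
            - (v.imI * d.imI + v.imJ * d.imJ + v.imK * d.imK) * x.imK)
      have := congrArg (fun q => (dot x x * dot d d)⁻¹ • q) key
      simp only [smul_smul, smul_add] at this
      rw [inv_mul_cancel₀ (mul_pos hx hd0).ne', one_smul] at this
      refine Eq.trans ?_ this.symm
      congr 2 <;> field_simp

theorem sum_smul_ijk (q : Quaternion ℝ) (hq : q.re = 0) :
    q.imI • ijk 0 + q.imJ • ijk 1 + q.imK • ijk 2 = q := by
  refine Quaternion.ext _ _ ?_ ?_ ?_ ?_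
  · change q.imI * 0 + q.imJ * 0 + q.imK * 0 = q.re
    rw [hq]; ring
  · change q.imI * 1 + q.imJ * 0 + q.imK * 0 = q.imI
    ring
  · change q.imI * 0 + q.imJ * 1 + q.imK * 0 = q.imJ
    ring
  · change q.imI * 0 + q.imJ * 0 + q.imK * 1 = q.imK
    ring

theorem hasDet_ijk {w : Fin 3 → Quaternion ℝ} (hw : ∀ i, (w i).re = 0) :
    HasDet ijk w (triple (w 0) (w 1) (w 2)) := by
  refine ⟨Matrix.transpose !![(w 0).imI, (w 0).imJ, (w 0).imK; (w 1).imI, (w 1).imJ, (w 1).imK;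
    (w 2).imI, (w 2).imJ, (w 2).imK], Matrix.det_transpose _, fun j => ?_⟩
  rw [← sum_smul_ijk (w j) (hw j), Fin.sum_univ_three]
  fin_cases j <;> rfl

/-- Passing to another frame multiplies the triple product with `x` by the determinant, and on `(d,
x × d)` its value is `|x|² |d|² > 0`. -/
theorem sphere_orients {x d : Quaternion ℝ} (hd : d ∈ sphereTangent x)
    (hx : 0 < dot x x) (hd0 : 0 < dot d d) :
    Orients (sphereTangent x) ![d, cross x d]
      (fun a => IsFrame (sphereTangent x) a ∧ 0 < triple x (a 0) (a 1)) := by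
  have hF := sphereTangent_isFrame hd hx hd0
  have key : ∀ {a : Fin 2 → Quaternion ℝ} {δ : ℝ}, HasDet ![d, cross x d] a δ →
      triple x (a 0) (a 1) = δ * (dot x x * dot d d) := by
    rintro a _ ⟨A, rfl, hA⟩
    have hdx := hd.2
    rw [triple_eq, ← dot_cross_self hd, hA, hA, Matrix.det_fin_two]
    simp only [Fin.sum_univ_two, Matrix.cons_val_zero, Matrix.cons_val_one]
    simp [dot]
    ring
  have hpos := mul_pos hx hd0
  refine ⟨hF, fun a => ⟨fun ⟨h1, h2⟩ => ?_, fun h => ?_⟩⟩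
  · obtain ⟨δ, h⟩ := exists_hasDet (e := ![d, cross x d]) (e' := a)
      (fun j => by rw [hF.2]; exact h1.mem j)
    rw [key h] at h2
    exact h.sameOrientation (pos_of_mul_pos_left h2 hpos.le)
  · refine ⟨h.isFrame hF, ?_⟩
    obtain ⟨δ, hδ, h⟩ := sameOrientation_iff_hasDet.1 h
    rw [key h]
    exact mul_pos hδ hpos

end Algebra

/-! ### Frames of the tangent spaces at a point of the diagonal -/

section PairFrames

/-- The infinitesimal conjugation of the pair `(x, y)` by `a`. -/
def orbitMap (x y : Quaternion ℝ) : Quaternion ℝ →ₗ[ℝ] Quaternion ℝ × Quaternion ℝ where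
  toFun a := (a * x - x * a, a * y - y * a)
  map_add' a b := by ext1 <;> simp only [Prod.mk_add_mk] <;> noncomm_ring
  map_smul' r a := by
    ext1 <;> simp only [smul_mul_assoc, mul_smul_comm, ← smul_sub, RingHom.id_apply, Prod.smul_mk]

theorem orbitMap_apply (x y a : Quaternion ℝ) :
    orbitMap x y a = (a * x - x * a, a * y - y * a) := rfl

/-- The derivative of the product at `(x, y)`. -/
def mulDeriv (x y : Quaternion ℝ) : Quaternion ℝ × Quaternion ℝ →ₗ[ℝ] Quaternion ℝ where
  toFun v := v.1 * y + x * v.2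
  map_add' a b := by simp only [Prod.fst_add, Prod.snd_add]; noncomm_ring
  map_smul' r a := by
    simp only [smul_mul_assoc, mul_smul_comm, smul_add, RingHom.id_apply, Prod.smul_fst,
      Prod.smul_snd]

theorem mulDeriv_apply (x y : Quaternion ℝ) (v : Quaternion ℝ × Quaternion ℝ) :
    mulDeriv x y v = v.1 * y + x * v.2 := rfl

theorem mulDeriv_orbitMap (x y a : Quaternion ℝ) :
    mulDeriv x y (orbitMap x y a) = a * (x * y) - x * y * a := by
  rw [mulDeriv_apply, orbitMap_apply]; noncomm_ring

theorem mulDeriv_orbitMap_re (x y a : Quaternion ℝ) :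
    (mulDeriv x y (orbitMap x y a)).re = 0 := by
  rw [mulDeriv_orbitMap, Quaternion.re_sub, sub_eq_zero]
  simp only [Quaternion.re_mul]
  ring

/-- Tangent space of a product of two conjugacy classes. -/
def pairTangent (x y : Quaternion ℝ) : Submodule ℝ (Quaternion ℝ × Quaternion ℝ) :=
  (sphereTangent x).prod (sphereTangent y)

theorem orbitMap_mem (x y a : Quaternion ℝ) : orbitMap x y a ∈ pairTangent x y :=
  ⟨commutator_mem_sphereTangent _ _, commutator_mem_sphereTangent _ _⟩

/-- A positive frame of the tangent space of the product of two conjugacy classes. -/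
def pairFrame (x y : Quaternion ℝ) : Fin 4 → Quaternion ℝ × Quaternion ℝ :=
  Fin.append (m := 2) (n := 2) (fun i => (![cross x y, cross x (cross x y)] i, 0))
    (fun j => (0, ![cross x y, cross y (cross x y)] j))

theorem pairFrame_eq (x y : Quaternion ℝ) : pairFrame x y =
    ![(cross x y, 0), (cross x (cross x y), 0), (0, cross x y), (0, cross y (cross x y))] := by
  funext i
  fin_cases i <;> rfl

theorem dot_self_pos_left {x y : Quaternion ℝ} (hc : 0 < dot (cross x y) (cross x y)) :
    0 < dot x x := by
  refine (dot_self_nonneg x).lt_of_ne' fun h => hc.ne' ?_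
  have : dot (cross x y) (cross x y) = dot x x * dot y y - dot x y ^ 2 := by
    simp only [dot, cross_imI, cross_imJ, cross_imK]; ring
  rw [h] at this
  nlinarith [sq_nonneg (dot x y)]

theorem dot_self_pos_right {x y : Quaternion ℝ} (hc : 0 < dot (cross x y) (cross x y)) :
    0 < dot y y := by
  refine dot_self_pos_left (y := x) ?_
  have : dot (cross x y) (cross x y) = dot (cross y x) (cross y x) := by
    simp only [dot, cross_imI, cross_imJ, cross_imK]; ring
  rwa [← this]

theorem pair_orients {x y : Quaternion ℝ} (hc : 0 < dot (cross x y) (cross x y)) :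
    Orients (pairTangent x y) (pairFrame x y) (ProdPositive (m := 2) (n := 2)
      (fun a => IsFrame (sphereTangent x) a ∧ 0 < triple x (a 0) (a 1))
      (fun a => IsFrame (sphereTangent y) a ∧ 0 < triple y (a 0) (a 1))) :=
  (sphere_orients (cross_mem_sphereTangent x y) (dot_self_pos_left hc) hc).prod
    (sphere_orients (cross_mem_sphereTangent_right x y) (dot_self_pos_right hc) hc)

/-- A tangent vector of `R₂` that is transverse to the orbits. -/
def slice (x y : Quaternion ℝ) : Quaternion ℝ × Quaternion ℝ := (cross x (cross x y), 0)

theorem mulDeriv_slice_re (x y : Quaternion ℝ) :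
    (mulDeriv x y (slice x y)).re = dot (cross x y) (cross x y) := by
  simp [mulDeriv_apply, slice, dot]; ring

theorem slice_mem (x y : Quaternion ℝ) : slice x y ∈ pairTangent x y :=
  ⟨cross_mem_sphereTangent _ _, zero_mem _⟩

theorem orbitMap_left (x y : Quaternion ℝ) : orbitMap x y x = (2 : ℝ) • (0, cross x y) := by
  rw [orbitMap_apply]
  refine Prod.ext (by simp) (Quaternion.ext _ _ ?_ ?_ ?_ ?_) <;> simp <;> ring

theorem orbitMap_right (x y : Quaternion ℝ) : orbitMap x y y = (-2 : ℝ) • (cross x y, 0) := by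
  rw [orbitMap_apply]
  refine Prod.ext (Quaternion.ext _ _ ?_ ?_ ?_ ?_) (by simp) <;> simp <;> ring

theorem orbitMap_cross (x y : Quaternion ℝ) : orbitMap x y (cross x y) =
    (-2 : ℝ) • (cross x (cross x y), 0) + (-2 : ℝ) • (0, cross y (cross x y)) := by
  rw [orbitMap_apply]
  refine Prod.ext (Quaternion.ext _ _ ?_ ?_ ?_ ?_) (Quaternion.ext _ _ ?_ ?_ ?_ ?_) <;>
    simp <;> ring

/-- The imaginary part of `x y` is that of `Re(x) y + Re(y) x + x × y`, and real parts act
trivially, so this combines the three preceding formulas. -/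
theorem orbitMap_mul (x y : Quaternion ℝ) : orbitMap x y (x * y) =
    (-2 * x.re) • (cross x y, 0) + (-2 : ℝ) • (cross x (cross x y), 0) +
      (2 * y.re) • (0, cross x y) + (-2 : ℝ) • (0, cross y (cross x y)) := by
  rw [orbitMap_apply]
  refine Prod.ext (Quaternion.ext _ _ ?_ ?_ ?_ ?_) (Quaternion.ext _ _ ?_ ?_ ?_ ?_) <;>
    simp <;> ring

/-- The directions `i, j, k` of the orbit of a pair. -/
def pairOrbitFrame (x y : Quaternion ℝ) (s : Fin 3) : Quaternion ℝ × Quaternion ℝ :=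
  orbitMap x y (ijk s)

theorem orbitMap_im (x y a : Quaternion ℝ) : orbitMap x y a.im = orbitMap x y a := by
  rw [orbitMap_apply, orbitMap_apply]
  refine Prod.ext (Quaternion.ext _ _ ?_ ?_ ?_ ?_) (Quaternion.ext _ _ ?_ ?_ ?_ ?_) <;>
    simp <;> ring

/-- The triple product of `Im x`, `Im y`, `x × y` is `|x × y|²`. Orbit directions can thus be taken
along `x`, `y`, `x × y`, where they have simple coordinates. -/
theorem sameOrientation_ijk {x y : Quaternion ℝ} (hc : 0 < dot (cross x y) (cross x y)) :
    SameOrientation ![x.im, y.im, cross x y] ijk := by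
  refine SameOrientation.symm (HasDet.sameOrientation (hasDet_ijk (w := ![x.im, y.im, cross x y])
    fun i => by fin_cases i <;> simp) ?_)
  have : triple x.im y.im (cross x y) = dot (cross x y) (cross x y) := by
    rw [triple_eq]; simp [dot]; ring
  exact this ▸ hc

theorem sameOrientation_pairOrbitFrame {x y : Quaternion ℝ}
    (hc : 0 < dot (cross x y) (cross x y)) :
    SameOrientation ![orbitMap x y x, orbitMap x y y, orbitMap x y (cross x y)]
      (pairOrbitFrame x y) := by
  have h := (sameOrientation_ijk hc).map (orbitMap x y)
  have e : (fun i => orbitMap x y (![x.im, y.im, cross x y] i)) =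
      ![orbitMap x y x, orbitMap x y y, orbitMap x y (cross x y)] := by
    funext i
    fin_cases i
    · exact orbitMap_im x y x
    · exact orbitMap_im x y y
    · rfl
  rwa [e] at h

theorem sameOrientation_slice {x y : Quaternion ℝ} (hc : 0 < dot (cross x y) (cross x y)) :
    SameOrientation (pairFrame x y) (Fin.append ![slice x y] (pairOrbitFrame x y)) := by
  have h1 : SameOrientation (pairFrame x y) (Fin.append ![slice x y]
      ![orbitMap x y x, orbitMap x y y, orbitMap x y (cross x y)]) := by
    -- The columns are the coordinates of `slice` and of the orbit vectors of `x`, `y`, `x × y` in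
    -- `pairFrame`; the determinant is `8`.
    refine ⟨!![0, 0, -2, 0; 1, 0, 0, -2; 0, 2, 0, 0; 0, 0, 0, -2], ?_, fun j => ?_⟩
    · simp [Matrix.det_succ_row_zero, Fin.sum_univ_succ, Fin.succAbove]
    · rw [pairFrame_eq, Fin.sum_univ_four]
      fin_cases j
      · change slice x y = _
        simp [slice]
      · change orbitMap x y x = _
        rw [orbitMap_left]
        simp
      · change orbitMap x y y = _
        rw [orbitMap_right]
        simp
      · change orbitMap x y (cross x y) = _
        rw [orbitMap_cross]
        simp
  refine h1.trans (SameOrientation.append_of_mod 1 (by simp) (fun j => ?_)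
    (sameOrientation_pairOrbitFrame hc))
  rw [Subsingleton.elim j 0]
  simp

/-- The linear parametrization of the tangent space of a graph. -/
def graphMap (x y : Quaternion ℝ) (κ : ℝ) : Quaternion ℝ × Quaternion ℝ →ₗ[ℝ] Amb where
  toFun v := (v, v + (κ * (mulDeriv x y v).re) • orbitMap x y (x * y))
  map_add' a b := by
    simp only [map_add, Quaternion.re_add, mul_add, add_smul, Prod.mk_add_mk]
    congr 1
    abel
  map_smul' r a := by
    simp only [map_smul, Quaternion.re_smul, RingHom.id_apply, Prod.smul_mk, smul_add, smul_smul,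
      smul_eq_mul]
    congr 3
    ring

theorem graphMap_apply (x y : Quaternion ℝ) (κ : ℝ) (v : Quaternion ℝ × Quaternion ℝ) :
    graphMap x y κ v = (v, v + (κ * (mulDeriv x y v).re) • orbitMap x y (x * y)) := rfl

theorem graphMap_injective (x y : Quaternion ℝ) (κ : ℝ) : Function.Injective (graphMap x y κ) :=
  fun _ _ h => congrArg Prod.fst h

theorem graphMap_orbitMap (x y : Quaternion ℝ) (κ : ℝ) (a : Quaternion ℝ) :
    graphMap x y κ (orbitMap x y a) = (orbitMap x y a, orbitMap x y a) := by
  rw [graphMap_apply, mulDeriv_orbitMap_re, mul_zero, zero_smul, add_zero]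

/-- Tangent space of the graph. -/
def graphTangent (x y : Quaternion ℝ) (κ : ℝ) : Submodule ℝ Amb :=
  (pairTangent x y).map (graphMap x y κ)

theorem eq_graphMap_of_mem {x y : Quaternion ℝ} {κ : ℝ} {z : Amb} (h : z ∈ graphTangent x y κ) :
    z = graphMap x y κ z.1 := by
  obtain ⟨v, -, rfl⟩ := h
  rfl

/-- The directions `i, j, k` of the orbit of a point of the diagonal. -/
def diagOrbitFrame (x y : Quaternion ℝ) (s : Fin 3) : Amb :=
  (pairOrbitFrame x y s, pairOrbitFrame x y s)

theorem graphMap_pairOrbitFrame (x y : Quaternion ℝ) (κ : ℝ) (s : Fin 3) :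
    graphMap x y κ (pairOrbitFrame x y s) = diagOrbitFrame x y s := graphMap_orbitMap x y κ _

/-- The injective map `graphMap` carries orbit directions of the pair to those of the quadruple,
whatever `κ` is, because these have `Re dμ = 0`. -/
theorem graph_frame_iff {x y : Quaternion ℝ} (κ : ℝ) {v : Quaternion ℝ × Quaternion ℝ} :
    IsFrame (graphTangent x y κ) (Fin.append ![graphMap x y κ v] (diagOrbitFrame x y)) ↔
      IsFrame (pairTangent x y) (Fin.append ![v] (pairOrbitFrame x y)) := by
  have e : Fin.append ![graphMap x y κ v] (diagOrbitFrame x y) =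
      graphMap x y κ ∘ Fin.append ![v] (pairOrbitFrame x y) := by
    funext i
    refine Fin.addCases (fun j => ?_) (fun j => ?_) i
    · simp
    · simp [graphMap_pairOrbitFrame]
  unfold IsFrame graphTangent
  rw [e, Set.range_comp, ← Submodule.map_span,
    (graphMap x y κ).linearIndependent_iff (LinearMap.ker_eq_bot.2 (graphMap_injective x y κ)),
    (Submodule.map_injective_of_injective (graphMap_injective x y κ)).eq_iff]

/-- Positive tangent vectors of the quotient of a graph. -/
theorem exists_pos_of_graph {x y : Quaternion ℝ} (hc : 0 < dot (cross x y) (cross x y)) {κ : ℝ}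
    {e : Amb} (he : e ∈ graphTangent x y κ)
    (h : SameOrientation (pairFrame x y) (Fin.append ![e.1] (pairOrbitFrame x y))) :
    ∃ r : ℝ, 0 < r ∧ e - r • graphMap x y κ (slice x y) ∈
      Submodule.span ℝ (Set.range (diagOrbitFrame x y)) := by
  have h1 := sameOrientation_slice hc
  obtain ⟨r, hr, hm⟩ := exists_pos_of_sameOrientation_append
    (h1.isFrame (pair_orients hc).1).1 (h1.symm.trans h)
  refine ⟨r, hr, ?_⟩
  rw [eq_graphMap_of_mem he, ← map_smul, ← map_sub]
  have := Submodule.mem_map_of_mem (f := graphMap x y κ) hm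
  rw [Submodule.map_span, ← Set.range_comp] at this
  convert this using 3
  funext s
  exact (graphMap_pairOrbitFrame x y κ s).symm

end PairFrames

/-! ### The determinant that decides the sign -/

section QuadFrames

/-- The positive frame of `R₂ × R₂`. -/
def quadFrame (x y : Quaternion ℝ) : Fin 8 → Amb :=
  Fin.append (m := 4) (n := 4) (fun i => (pairFrame x y i, 0)) (fun j => (0, pairFrame x y j))

/-- Three vectors which are mapped to a frame of `su(2)` by the derivative of the product. -/
def normalFrame (x y : Quaternion ℝ) : Fin 3 → Amb :=
  ![((cross x y, 0), 0), ((cross x (cross x y), 0), 0), ((0, cross x y), 0)]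

/-- The remaining vectors of the frame of `R₂ × R₂`. -/
def restFrame (x y : Quaternion ℝ) : Fin 5 → Amb :=
  ![((0, cross y (cross x y)), 0), (0, (cross x y, 0)), (0, (cross x (cross x y), 0)),
    (0, (0, cross x y)), (0, (0, cross y (cross x y)))]

theorem quadFrame_eq (x y : Quaternion ℝ) :
    quadFrame x y = Fin.append (normalFrame x y) (restFrame x y) := by
  rw [quadFrame, pairFrame_eq]
  funext i
  fin_cases i <;> rfl

/-- The frame of the tangent space of `H₂` formed by tangent vectors of the diagonal, of the graph,
and of the orbit. -/
def levelFrame (x y : Quaternion ℝ) (κ : ℝ) : Fin 5 → Amb :=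
  Fin.append (m := 2) (n := 3) ![graphMap x y 0 (slice x y), graphMap x y κ (slice x y)]
    (diagOrbitFrame x y)

/-- The same frame with the first two vectors interchanged. -/
def levelFrame' (x y : Quaternion ℝ) (κ : ℝ) : Fin 5 → Amb :=
  Fin.append (m := 2) (n := 3) ![graphMap x y κ (slice x y), graphMap x y 0 (slice x y)]
    (diagOrbitFrame x y)

theorem hasDet_swap (x y : Quaternion ℝ) (κ : ℝ) :
    HasDet (levelFrame x y κ) (levelFrame' x y κ) (-1) := by
  have h := HasDet.append_of_mod
    (a := ![graphMap x y 0 (slice x y), graphMap x y κ (slice x y)])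
    (a' := ![graphMap x y κ (slice x y), graphMap x y 0 (slice x y)])
    !![0, 1; 1, 0] (fun j => ?_) (HasDet.refl (diagOrbitFrame x y))
  · rw [Matrix.det_fin_two] at h
    norm_num at h
    exact h
  · fin_cases j <;> simp

theorem HasDet.append_left {V : Type*} [AddCommGroup V] [Module ℝ V] {m n : ℕ} (a : Fin m → V)
    {b b' : Fin n → V} {d : ℝ} (h : HasDet b b' d) :
    HasDet (Fin.append a b) (Fin.append a b') d := by
  obtain ⟨E, rfl, hE⟩ := h
  exact HasDet.append_left_of_mod E fun j => by rw [hE, sub_self]; exact zero_mem _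

theorem graphMap_slice (x y : Quaternion ℝ) (κ : ℝ) : graphMap x y κ (slice x y) =
    (slice x y, slice x y + (κ * dot (cross x y) (cross x y)) • orbitMap x y (x * y)) := by
  rw [graphMap_apply, mulDeriv_slice_re]

theorem sameOrientation_diagOrbitFrame {x y : Quaternion ℝ}
    (hc : 0 < dot (cross x y) (cross x y)) :
    SameOrientation ![((orbitMap x y x, orbitMap x y x) : Amb), (orbitMap x y y, orbitMap x y y),
      (orbitMap x y (cross x y), orbitMap x y (cross x y))] (diagOrbitFrame x y) := by
  have h := (sameOrientation_pairOrbitFrame hc).map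
    (LinearMap.prod LinearMap.id LinearMap.id)
  convert h using 1
  · funext i
    fin_cases i <;> rfl
  · rfl

/-- The two slice vectors differ by `(0, κ |c|² O(P))`, so the determinant is linear in `κ`; its
sign is the content of the proposition. -/
theorem exists_hasDet_levelFrame {x y : Quaternion ℝ} (hc : 0 < dot (cross x y) (cross x y))
    (κ : ℝ) : ∃ r : ℝ, 0 < r ∧
      HasDet (quadFrame x y) (Fin.append (normalFrame x y) (levelFrame x y κ)) (-κ * r) := by
  obtain ⟨d, hd, h⟩ := sameOrientation_iff_hasDet.1 (sameOrientation_diagOrbitFrame hc)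
  set D := dot (cross x y) (cross x y) with hD
  set o : Fin 3 → Amb := ![((orbitMap x y x, orbitMap x y x) : Amb),
    (orbitMap x y y, orbitMap x y y), (orbitMap x y (cross x y), orbitMap x y (cross x y))] with ho
  have h1 : HasDet (Fin.append (m := 2) (n := 3)
      ![graphMap x y 0 (slice x y), graphMap x y κ (slice x y)] o) (levelFrame x y κ) (1 * d) := by
    rw [← Matrix.det_one (n := Fin 2) (R := ℝ)]
    refine HasDet.append_of_mod _ (fun j => ?_) h
    simp [Matrix.one_apply]
  have h2 : HasDet (Fin.append (normalFrame x y) (restFrame x y))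
      (Fin.append (normalFrame x y) (Fin.append (m := 2) (n := 3)
      ![graphMap x y 0 (slice x y), graphMap x y κ (slice x y)] o)) (-16 * (κ * D)) := by
    have hdet : (!![0, 0, 0, 0, -2;
      0, κ * D * (-2 * x.re), 0, -2, 0;
      1, 1 + κ * D * (-2), 0, 0, -2;
      0, κ * D * (2 * y.re), 2, 0, 0;
      0, κ * D * (-2), 0, 0, -2] : Matrix (Fin 5) (Fin 5) ℝ).det = -16 * (κ * D) := by
      simp [Matrix.det_succ_row_zero, Fin.sum_univ_succ, Fin.succAbove]
      ring
    rw [← hdet]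
    have hn : ∀ a b c : ℝ, ((a • (cross x y, (0 : Quaternion ℝ)) +
        b • (cross x (cross x y), (0 : Quaternion ℝ)) + c • ((0 : Quaternion ℝ), cross x y), 0) :
          Amb) ∈ Submodule.span ℝ (Set.range (normalFrame x y)) := by
      intro a b c
      convert sum_mem_span (normalFrame x y) ![a, b, c] using 1
      simp [Fin.sum_univ_three, normalFrame]
    refine HasDet.append_left_of_mod _ fun j => ?_
    simp only [Fin.sum_univ_five]
    fin_cases j
    · change graphMap x y 0 (slice x y) - _ ∈ _
      convert hn 0 1 0 using 1
      rw [graphMap_slice]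
      simp [restFrame, slice]
    · change graphMap x y κ (slice x y) - _ ∈ _
      convert hn 0 1 0 using 1
      rw [graphMap_slice, orbitMap_mul]
      simp [restFrame, slice]
      rw [← hD]
      constructor <;> module
    · change ((orbitMap x y x, orbitMap x y x) : Amb) - _ ∈ _
      convert hn 0 0 2 using 1
      rw [orbitMap_left]
      simp [restFrame]
    · change ((orbitMap x y y, orbitMap x y y) : Amb) - _ ∈ _
      convert hn (-2) 0 0 using 1
      rw [orbitMap_right]
      simp [restFrame]
    · change ((orbitMap x y (cross x y), orbitMap x y (cross x y)) : Amb) - _ ∈ _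
      convert hn 0 (-2) 0 using 1
      rw [orbitMap_cross]
      simp [restFrame]
  refine ⟨16 * D * d, by positivity, ?_⟩
  rw [quadFrame_eq]
  convert h2.trans (h1.append_left _) using 1
  ring

end QuadFrames

/-! ### The tangent space of `H₂` and the derivative of `f` on the diagonal -/

section Level

theorem exists_pair_coeff {x y : Quaternion ℝ} (hc : 0 < dot (cross x y) (cross x y))
    {v : Quaternion ℝ × Quaternion ℝ} (hv : v ∈ pairTangent x y) : ∃ a b e f : ℝ,
      v = (a • cross x y + b • cross x (cross x y), e • cross x y + f • cross y (cross x y)) := by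
  rw [← (pair_orients hc).1.2] at hv
  obtain ⟨c, h⟩ := exists_coeff hv
  refine ⟨c 0, c 1, c 2, c 3, ?_⟩
  rw [h, Fin.sum_univ_four, pairFrame_eq]
  simp

/-- The kernel of the derivative of the product is spanned by the infinitesimal conjugation by the
product. -/
theorem exists_smul_of_mulDeriv_eq_zero {x y : Quaternion ℝ} (hx : x ∈ unitary (Quaternion ℝ))
    (hy : y ∈ unitary (Quaternion ℝ)) (hc : 0 < dot (cross x y) (cross x y))
    {v : Quaternion ℝ × Quaternion ℝ} (hv : v ∈ pairTangent x y) (h : mulDeriv x y v = 0) :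
    ∃ s : ℝ, v = s • orbitMap x y (x * y) := by
  obtain ⟨a, b, e, f, rfl⟩ := exists_pair_coeff hc hv
  -- The `(0, y × c)` component of `O(P)` is `-2`, so this multiple removes `f`. What remains is a
  -- kernel vector without that component, to be shown zero.
  refine ⟨-f / 2, ?_⟩
  rw [← sub_eq_zero]
  have hO : mulDeriv x y (orbitMap x y (x * y)) = 0 := by rw [mulDeriv_orbitMap, sub_self]
  have hv0 : mulDeriv x y ((a • cross x y + b • cross x (cross x y),
      e • cross x y + f • cross y (cross x y)) - (-f / 2) • orbitMap x y (x * y)) = 0 := by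
    rw [map_sub, h, map_smul, hO, smul_zero, sub_zero]
  have hred : ((a • cross x y + b • cross x (cross x y),
      e • cross x y + f • cross y (cross x y)) - (-f / 2) • orbitMap x y (x * y)) =
      ((a - f * x.re) • cross x y + (b - f) • cross x (cross x y),
        (e + f * y.re) • cross x y) := by
    rw [orbitMap_mul]
    ext1
    · simp only [Prod.smul_mk, Prod.mk_add_mk, Prod.mk_sub_mk, smul_zero]
      module
    · simp only [Prod.smul_mk, Prod.mk_add_mk, Prod.mk_sub_mk, smul_zero]
      module
  rw [hred] at hv0 ⊢
  generalize a - f * x.re = a' at *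
  generalize b - f = b' at *
  generalize e + f * y.re = e' at *
  rw [mulDeriv_apply] at hv0
  simp only at hv0
  have he : e' = 0 := by
    -- Multiplying `p y + x q = 0` by the conjugates of `x` on the left and `y` on the right
    -- decouples the unknowns: the scalar product with `x` kills the term in `p`.
    have h2 : star x * (a' • cross x y + b' • cross x (cross x y)) +
        (e' • cross x y) * star y = 0 := by
      generalize a' • cross x y + b' • cross x (cross x y) = p at *
      generalize e' • cross x y = q at *
      calc star x * p + q * star y = star x * p * (y * star y) + star x * x * q * star y := by
            rw [hx.1, hy.2, mul_one, one_mul]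
        _ = star x * (p * y + x * q) * star y := by noncomm_ring
        _ = 0 := by rw [hv0, mul_zero, zero_mul]
    have h3 : dot x (star x * (a' • cross x y + b' • cross x (cross x y)) +
        (e' • cross x y) * star y) = e' * dot (cross x y) (cross x y) := by
      simp [dot]; ring
    rw [h2, dot_zero] at h3
    exact (mul_eq_zero.1 h3.symm).resolve_right hc.ne'
  rw [he, zero_smul, mul_zero, add_zero] at hv0
  have h4 : a' • cross x y + b' • cross x (cross x y) = 0 := by
    have := congrArg (· * star y) hv0
    simp only [mul_assoc, zero_mul] at this
    rwa [hy.2, mul_one] at this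
  rw [h4, he, zero_smul]
  rfl

/-- The tangent space of `H₂` at a point of the diagonal. -/
def levelTangent (x y : Quaternion ℝ) : Submodule ℝ Amb :=
  (pairTangent x y).prod (pairTangent x y) ⊓ LinearMap.ker
    ((mulDeriv x y).comp (LinearMap.fst ℝ _ _) - (mulDeriv x y).comp (LinearMap.snd ℝ _ _))

theorem mem_levelTangent {x y : Quaternion ℝ} {z : Amb} : z ∈ levelTangent x y ↔
    z.1 ∈ pairTangent x y ∧ z.2 ∈ pairTangent x y ∧ mulDeriv x y z.1 = mulDeriv x y z.2 := by
  unfold levelTangent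
  rw [Submodule.mem_inf, Submodule.mem_prod, LinearMap.mem_ker, LinearMap.sub_apply, sub_eq_zero,
    and_assoc]
  rfl

theorem graphTangent_le (x y : Quaternion ℝ) (κ : ℝ) :
    graphTangent x y κ ≤ levelTangent x y := by
  rintro _ ⟨v, hv, rfl⟩
  rw [mem_levelTangent, graphMap_apply]
  refine ⟨hv, add_mem hv (Submodule.smul_mem _ _ (orbitMap_mem _ _ _)), ?_⟩
  rw [map_add, map_smul, mulDeriv_orbitMap, sub_self, smul_zero, add_zero]

theorem levelTangent_le_span {x y : Quaternion ℝ} (hx : x ∈ unitary (Quaternion ℝ))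
    (hy : y ∈ unitary (Quaternion ℝ)) (hc : 0 < dot (cross x y) (cross x y)) {κ : ℝ}
    (hκ : κ ≠ 0) :
    levelTangent x y ≤ Submodule.span ℝ (Set.range (levelFrame x y κ)) := by
  intro z hz
  obtain ⟨h1, h2, h3⟩ := mem_levelTangent.1 hz
  obtain ⟨s, hs⟩ := exists_smul_of_mulDeriv_eq_zero hx hy hc (sub_mem h2 h1)
    (by rw [map_sub, h3, sub_self])
  have hm : ∀ i, levelFrame x y κ i ∈ Submodule.span ℝ (Set.range (levelFrame x y κ)) :=
    fun i => Submodule.subset_span ⟨i, rfl⟩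
  -- `z - (z.1, z.1) = (0, s O(P))`, and the two slice vectors differ by `(0, κ |c|² O(P))`.
  have e : z = graphMap x y 0 z.1 + (s / (κ * dot (cross x y) (cross x y))) •
      (levelFrame x y κ 1 - levelFrame x y κ 0) := by
    change z = graphMap x y 0 z.1 + (s / (κ * dot (cross x y) (cross x y))) •
      (graphMap x y κ (slice x y) - graphMap x y 0 (slice x y))
    rw [graphMap_slice, graphMap_slice, graphMap_apply]
    have hne : κ * dot (cross x y) (cross x y) ≠ 0 := mul_ne_zero hκ hc.ne'
    refine Prod.ext ?_ ?_
    · simp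
    · have : z.2 = z.1 + s • orbitMap x y (x * y) := by rw [← hs]; abel
      simp only [Prod.snd_add, Prod.smul_snd, Prod.snd_sub, zero_mul, zero_smul, add_zero,
        add_sub_cancel_left, smul_smul, div_mul_cancel₀ _ hne, this]
  rw [e]
  refine add_mem ?_ (Submodule.smul_mem _ _ (sub_mem (hm 1) (hm 0)))
  have hF := (sameOrientation_slice hc).isFrame (pair_orients hc).1
  rw [← hF.2] at h1
  obtain ⟨c, h1⟩ := exists_coeff h1
  rw [h1, map_sum]
  refine Submodule.sum_mem _ fun i _ => ?_
  rw [map_smul]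
  refine Submodule.smul_mem _ _ ?_
  refine Fin.addCases (fun j => ?_) (fun j => ?_) i
  · rw [Fin.append_left, Subsingleton.elim j 0]
    exact hm 0
  · rw [Fin.append_right, graphMap_pairOrbitFrame]
    convert hm (Fin.natAdd 2 j) using 1
    exact (Fin.append_right (m := 2) (n := 3) _ _ j).symm

theorem levelFrame_mem (x y : Quaternion ℝ) (κ : ℝ) (i : Fin 5) :
    levelFrame x y κ i ∈ levelTangent x y := by
  refine Fin.addCases (m := 2) (n := 3) (fun j => ?_) (fun j => ?_) i
  · rw [levelFrame, Fin.append_left]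
    fin_cases j
    · exact graphTangent_le x y 0 ⟨_, slice_mem x y, rfl⟩
    · exact graphTangent_le x y κ ⟨_, slice_mem x y, rfl⟩
  · rw [levelFrame, Fin.append_right, ← graphMap_pairOrbitFrame x y 0]
    exact graphTangent_le x y 0 ⟨_, orbitMap_mem _ _ _, rfl⟩

theorem quadFrame_isFrame {x y : Quaternion ℝ} (hc : 0 < dot (cross x y) (cross x y)) :
    IsFrame ((pairTangent x y).prod (pairTangent x y)) (quadFrame x y) :=
  (pair_orients hc).1.prod (pair_orients hc).1

/-- Independence comes from the non-zero determinant of the completed frame, spanning from the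
description of the kernel of `dμ`. -/
theorem levelFrame_isFrame {x y : Quaternion ℝ} (hx : x ∈ unitary (Quaternion ℝ))
    (hy : y ∈ unitary (Quaternion ℝ)) (hc : 0 < dot (cross x y) (cross x y)) {κ : ℝ}
    (hκ : κ ≠ 0) : IsFrame (levelTangent x y) (levelFrame x y κ) := by
  constructor
  · obtain ⟨r, hr, h⟩ := exists_hasDet_levelFrame hc κ
    have := (h.isFrame (mul_ne_zero (neg_ne_zero.2 hκ) hr.ne') (quadFrame_isFrame hc)).1.comp
      (Fin.natAdd 3 : Fin 5 → Fin (3 + 5)) (Fin.natAdd_injective 5 3)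
    convert this using 1
    funext i
    exact (Fin.append_right (m := 3) (n := 5) _ _ i).symm
  · refine le_antisymm ?_ (levelTangent_le_span hx hy hc hκ)
    rw [Submodule.span_le]
    rintro _ ⟨i, rfl⟩
    exact levelFrame_mem x y κ i

theorem graphTangent_sup {x y : Quaternion ℝ} (hx : x ∈ unitary (Quaternion ℝ))
    (hy : y ∈ unitary (Quaternion ℝ)) (hc : 0 < dot (cross x y) (cross x y)) {κ : ℝ}
    (hκ : κ ≠ 0) : graphTangent x y 0 ⊔ graphTangent x y κ = levelTangent x y := by
  refine le_antisymm (sup_le (graphTangent_le _ _ _) (graphTangent_le _ _ _)) ?_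
  refine (levelTangent_le_span hx hy hc hκ).trans ?_
  rw [Submodule.span_le]
  rintro _ ⟨i, rfl⟩
  refine Fin.addCases (m := 2) (n := 3) (fun j => ?_) (fun j => ?_) i
  · rw [levelFrame, Fin.append_left]
    fin_cases j
    · exact Submodule.mem_sup_left ⟨_, slice_mem x y, rfl⟩
    · exact Submodule.mem_sup_right ⟨_, slice_mem x y, rfl⟩
  · rw [levelFrame, Fin.append_right, ← graphMap_pairOrbitFrame x y 0]
    exact Submodule.mem_sup_left ⟨_, orbitMap_mem _ _ _, rfl⟩

/-- The derivative of `X₁ X₂ (Y₁ Y₂)⁻¹` at the diagonal. -/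
def ratioDeriv (x y : Quaternion ℝ) : Amb →ₗ[ℝ] Quaternion ℝ where
  toFun z := mulDeriv x y z.1 * star (x * y) + x * y * star (mulDeriv x y z.2)
  map_add' a b := by
    simp only [Prod.fst_add, Prod.snd_add, map_add, star_add]; noncomm_ring
  map_smul' r a := by
    have h : star (r • mulDeriv x y a.2) = r • star (mulDeriv x y a.2) := by ext <;> simp
    simp only [Prod.smul_fst, Prod.smul_snd, map_smul, h, smul_mul_assoc, mul_smul_comm, smul_add,
      RingHom.id_apply]

theorem ratioDeriv_apply (x y : Quaternion ℝ) (z : Amb) : ratioDeriv x y z =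
    mulDeriv x y z.1 * star (x * y) + x * y * star (mulDeriv x y z.2) := rfl

/-- The two products are conjugate to each other, so their sum is twice the Euclidean scalar product
of `x` and `v`, which vanishes. -/
theorem mul_star_eq_neg {x v : Quaternion ℝ} (hv : v ∈ sphereTangent x) :
    x * star v = -(v * star x) := by
  obtain ⟨h1, h2⟩ := hv
  simp only [dot] at h2
  refine Quaternion.ext _ _ ?_ ?_ ?_ ?_ <;> simp [h1]
  · linear_combination 2 * h2
  all_goals ring

/-- Infinitesimal form of `P P̄ = 1`. It turns `ratioDeriv x y z` into `(dμ z.1 - dμ z.2) P̄`, whose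
kernel is `levelTangent`. -/
theorem mul_star_mulDeriv {x y : Quaternion ℝ} (hy : y ∈ unitary (Quaternion ℝ)) {v : Quaternion ℝ × Quaternion ℝ}
    (hv : v ∈ pairTangent x y) :
    x * y * star (mulDeriv x y v) = -(mulDeriv x y v * star (x * y)) := by
  obtain ⟨h1, h2⟩ := hv
  have e1 := mul_star_eq_neg h1
  have e2 := mul_star_eq_neg h2
  rw [mulDeriv_apply, star_add, star_mul, star_mul, star_mul]
  calc x * y * (star y * star v.1 + star v.2 * star x)
      = x * (y * star y) * star v.1 + x * (y * star v.2) * star x := by noncomm_ring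
    _ = -(v.1 * (y * star y) * star x + x * v.2 * star y * star x) := by
        rw [hy.2, e2, mul_one, e1]; noncomm_ring
    _ = _ := by noncomm_ring

theorem mem_levelTangent_of_ratioDeriv {x y : Quaternion ℝ} (hx : x ∈ unitary (Quaternion ℝ))
    (hy : y ∈ unitary (Quaternion ℝ)) {z : Amb}
    (hz : z ∈ (pairTangent x y).prod (pairTangent x y)) (h : ratioDeriv x y z = 0) :
    z ∈ levelTangent x y := by
  refine mem_levelTangent.2 ⟨hz.1, hz.2, ?_⟩
  rw [ratioDeriv_apply, mul_star_mulDeriv hy hz.2, ← sub_eq_add_neg, ← sub_mul] at h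
  have hP : star (x * y) * (x * y) = 1 := (mul_mem hx hy : x * y ∈ unitary (Quaternion ℝ)).1
  have := congrArg (· * (x * y)) h
  simp only [mul_assoc (_ - _), hP, mul_one, zero_mul] at this
  exact sub_eq_zero.1 this

/-- The images are `c x̄`, `(x × c) x̄` and `x (c ȳ) x̄`. The first two have imaginary parts
perpendicular to `x`, and their triple product with any `q` is `|c|² (x · q)`; conjugation by `x`
preserves the scalar product with `x`, so the third contributes `x · (c ȳ) = |c|²`. The determinant
is `|c|⁴`. -/
theorem sameOrientation_ratioDeriv_normalFrame {x y : Quaternion ℝ}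
    (hx : x ∈ unitary (Quaternion ℝ)) (hy : y ∈ unitary (Quaternion ℝ))
    (hc : 0 < dot (cross x y) (cross x y)) :
    SameOrientation ijk (fun i => ratioDeriv x y (normalFrame x y i)) := by
  set c := cross x y with hcd
  have e0 : ratioDeriv x y (normalFrame x y 0) = c * star x := by
    change (c * y + x * 0) * star (x * y) + x * y * star (0 * y + x * 0) = _
    rw [mul_zero, zero_mul, add_zero, add_zero, star_zero, mul_zero, add_zero, star_mul, mul_assoc,
      ← mul_assoc y, hy.2, one_mul]
  have e1 : ratioDeriv x y (normalFrame x y 1) = cross x c * star x := by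
    change (cross x c * y + x * 0) * star (x * y) + x * y * star (0 * y + x * 0) = _
    rw [mul_zero, zero_mul, add_zero, add_zero, star_zero, mul_zero, add_zero, star_mul, mul_assoc,
      ← mul_assoc y, hy.2, one_mul]
  have e2 : ratioDeriv x y (normalFrame x y 2) = x * (c * star y) * star x := by
    change (0 * y + x * c) * star (x * y) + x * y * star (0 * y + x * 0) = _
    rw [mul_zero, zero_mul, zero_add, add_zero, star_zero, mul_zero, add_zero, star_mul]
    noncomm_ring
  have hn : x.re ^ 2 + dot x x = 1 := by
    have := congrArg QuaternionAlgebra.re hx.2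
    rw [Quaternion.re_one] at this
    simp at this
    simp only [dot]
    linarith
  have hxc : dot x c = 0 := (cross_mem_sphereTangent x y).2
  have hyc : dot y c = 0 := (cross_mem_sphereTangent_right x y).2
  have hxyc : dot x (c * star y) = dot c c := by
    rw [hcd]; simp [dot]; ring
  have hcyr : (c * star y).re = 0 := by
    rw [hcd]; simp; ring
  have hcr : c.re = 0 := rfl
  have hdet : triple (c * star x) (cross x c * star x) (x * (c * star y) * star x) =
      dot c c * dot c c := by
    have hz : dot x (x * (c * star y) * star x) = dot c c := by
      rw [← hxyc]
      have : dot x (x * (c * star y) * star x) =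
          (x.re ^ 2 + dot x x) * dot x (c * star y) := by
        generalize c * star y = q
        simp [dot]; ring
      rw [this, hn, one_mul]
    have hgen : ∀ q : Quaternion ℝ, triple (c * star x) (cross x c * star x) q =
        (x.re ^ 2 + dot x x) * dot c c * dot x q := by
      intro q
      clear_value c
      rw [triple_eq]
      -- With `c` abstract, the identity holds only up to a term containing `x · c`, which is then
      -- set to zero.
      have f1 : dot (c * star x) (cross (cross x c * star x) q) =
          dot (x.re • c + cross x c) (cross (x.re • cross x c - dot x x • c) q) +
            dot (x.re • c + cross x c) (cross x q) * dot x c := by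
        simp [dot, hcr]; ring
      have f2 : dot (x.re • c + cross x c) (cross (x.re • cross x c - dot x x • c) q) =
          (x.re ^ 2 + dot x x) * (dot c c * dot x q - dot x c * dot c q) := by
        simp [dot]; ring
      rw [f1, f2, hxc]
      ring
    rw [hgen, hz, hn, one_mul]
  have hre : ∀ i, (ratioDeriv x y (normalFrame x y i)).re = 0 := by
    intro i
    fin_cases i
    · change (ratioDeriv x y (normalFrame x y 0)).re = 0
      rw [e0, hcd]
      simp; ring
    · change (ratioDeriv x y (normalFrame x y 1)).re = 0
      rw [e1]
      simp; ring
    · change (ratioDeriv x y (normalFrame x y 2)).re = 0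
      rw [e2]
      generalize c * star y = q at *
      have : (x * q * star x).re = (x.re ^ 2 + dot x x) * q.re := by
        simp [dot]; ring
      rw [this, hcyr, mul_zero]
  have := hasDet_ijk hre
  rw [e0, e1, e2, hdet] at this
  exact this.sameOrientation (mul_pos hc hc)

end Level

/-! ### The base-fiber orientation of `H₂` -/

section LevelOrientation

/-- The base-fiber orientation of the tangent space of `H₂` at a point of the diagonal. -/
def LevelPositive (x y : Quaternion ℝ) (e : Fin 5 → Amb) : Prop :=
  IsFrame (levelTangent x y) e ∧ ∃ w : Fin 3 → Amb,
    SameOrientation ijk (fun i => ratioDeriv x y (w i)) ∧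
      SameOrientation (quadFrame x y) (Fin.append (m := 3) (n := 5) w e)

variable {x y : Quaternion ℝ}

theorem levelPositive_of_hasDet (hx : x ∈ unitary (Quaternion ℝ))
    (hy : y ∈ unitary (Quaternion ℝ)) (hc : 0 < dot (cross x y) (cross x y)) {e : Fin 5 → Amb}
    (he : IsFrame (levelTangent x y) e) {d : ℝ}
    (h : HasDet (quadFrame x y) (Fin.append (normalFrame x y) e) d) (hd : 0 < d) :
    LevelPositive x y e :=
  ⟨he, normalFrame x y, sameOrientation_ratioDeriv_normalFrame hx hy hc, h.sameOrientation hd⟩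

theorem normalFrame_mem (i : Fin 3) :
    normalFrame x y i ∈ (pairTangent x y).prod (pairTangent x y) := by
  fin_cases i
  · exact ⟨⟨cross_mem_sphereTangent _ _, zero_mem _⟩, zero_mem _⟩
  · exact ⟨⟨cross_mem_sphereTangent _ _, zero_mem _⟩, zero_mem _⟩
  · exact ⟨⟨zero_mem _, cross_mem_sphereTangent_right _ _⟩, zero_mem _⟩

/-- The base-fiber rule does not depend on the triple: two triples with equally oriented images
under `df` differ by a matrix of positive determinant modulo `ker df`, which the fiber frame spans.
Hence `normalFrame` decides. -/
theorem pos_of_levelPositive (hx : x ∈ unitary (Quaternion ℝ))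
    (hy : y ∈ unitary (Quaternion ℝ)) (hc : 0 < dot (cross x y) (cross x y))
    {e e' : Fin 5 → Amb} (he : IsFrame (levelTangent x y) e) (hee : SameOrientation e e') {d : ℝ}
    (h : HasDet (quadFrame x y) (Fin.append (normalFrame x y) e) d)
    (h' : LevelPositive x y e') : 0 < d := by
  obtain ⟨-, w, hw, hpos⟩ := h'
  obtain ⟨C, hC, hw⟩ := (sameOrientation_ratioDeriv_normalFrame hx hy hc).symm.trans hw
  have hF := quadFrame_isFrame hc
  have hmem : ∀ j, w j ∈ (pairTangent x y).prod (pairTangent x y) := by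
    intro j
    have := (hpos.isFrame hF).mem (Fin.castAdd 5 j)
    rwa [Fin.append_left] at this
  have key : SameOrientation (Fin.append (normalFrame x y) e) (Fin.append w e') := by
    refine SameOrientation.append_of_mod C hC (fun j => ?_) hee
    rw [he.2]
    refine mem_levelTangent_of_ratioDeriv hx hy (sub_mem (hmem j)
      (Submodule.sum_mem _ fun i _ => Submodule.smul_mem _ _ (normalFrame_mem i))) ?_
    rw [map_sub, map_sum, sub_eq_zero]
    simp only [map_smul]
    exact hw j
  obtain ⟨d', hd', h''⟩ := sameOrientation_iff_hasDet.1 (hpos.trans key.symm)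
  rw [HasDet.unique hF.1 h h'']
  exact hd'

/-- Positive multiples modulo the orbit do not change the orientation. -/
theorem sameOrientation_of_mod_orbit {V : Type*} [AddCommGroup V] [Module ℝ V] {a b a' b' : V}
    {o : Fin 3 → V} {r s : ℝ} (hr : 0 < r) (hs : 0 < s)
    (ha : a' - r • a ∈ Submodule.span ℝ (Set.range o))
    (hb : b' - s • b ∈ Submodule.span ℝ (Set.range o)) :
    SameOrientation (Fin.append (m := 2) ![a, b] o) (Fin.append (m := 2) ![a', b'] o) := by
  refine SameOrientation.append_of_mod !![r, 0; 0, s] ?_ (fun j => ?_) (.refl o)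
  · simp only [Matrix.det_fin_two_of, mul_zero, sub_zero]
    positivity
  · fin_cases j <;> simpa

end LevelOrientation

/-! ### Powers of `σ₁` as conjugations, and Chebyshev polynomials -/

section Braid

/-- The square of the generator is the conjugation by the product. -/
theorem sigmaOne_sq_apply (X : SU2 × SU2) : (sigmaOne ^ (2 : ℤ)) X =
    (X.1 * X.2 * X.1 * (X.1 * X.2)⁻¹, X.1 * X.2 * X.2 * (X.1 * X.2)⁻¹) := by
  change sigmaOne (sigmaOne X) = _
  simp [sigmaOne, mul_assoc]

/-- `σ₁ ^ 2` conjugates by `X₁ X₂` and does not change this product, so the conjugating elements of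
successive steps multiply. -/
theorem sigmaOne_zpow_apply (ℓ : ℤ) (X : SU2 × SU2) : (sigmaOne ^ (2 * ℓ)) X =
    ((X.1 * X.2) ^ ℓ * X.1 * ((X.1 * X.2) ^ ℓ)⁻¹,
      (X.1 * X.2) ^ ℓ * X.2 * ((X.1 * X.2) ^ ℓ)⁻¹) := by
  have hinv : ∀ X : SU2 × SU2, (sigmaOne ^ (2 : ℤ))⁻¹ X =
      ((X.1 * X.2)⁻¹ * X.1 * (X.1 * X.2), (X.1 * X.2)⁻¹ * X.2 * (X.1 * X.2)) := by
    intro X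
    rw [Equiv.Perm.inv_eq_iff_eq, sigmaOne_sq_apply]
    ext1 <;> simp [mul_assoc]
  rw [zpow_mul]
  induction ℓ using Int.induction_on generalizing X with
  | zero => simp
  | succ n ih =>
    rw [zpow_add_one, Equiv.Perm.mul_apply, sigmaOne_sq_apply, ih]
    have e : X.1 * X.2 * X.1 * (X.1 * X.2)⁻¹ * (X.1 * X.2 * X.2 * (X.1 * X.2)⁻¹) = X.1 * X.2 := by
      simp [mul_assoc]
    simp only [e, zpow_add_one]
    ext1 <;> simp only [mul_assoc, mul_inv_rev]
  | pred n ih =>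
    rw [zpow_sub_one, Equiv.Perm.mul_apply, hinv, ih]
    have e : (X.1 * X.2)⁻¹ * X.1 * (X.1 * X.2) * ((X.1 * X.2)⁻¹ * X.2 * (X.1 * X.2)) =
        X.1 * X.2 := by
      simp [mul_assoc]
    simp only [e, zpow_sub_one]
    ext1 <;> simp only [mul_assoc, mul_inv_rev, inv_inv]

open Polynomial Polynomial.Chebyshev

/-- Powers of unit quaternions in terms of Chebyshev polynomials. -/
theorem coe_zpow (P : SU2) (ℓ : ℤ) : ((P ^ ℓ : SU2) : Quaternion ℝ) =
    (U ℝ (ℓ - 1)).eval (P : Quaternion ℝ).re • (P : Quaternion ℝ) -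
      (U ℝ (ℓ - 2)).eval (P : Quaternion ℝ).re • 1 := by
  have hs : star (P : Quaternion ℝ) = (2 * (P : Quaternion ℝ).re) • 1 - (P : Quaternion ℝ) := by
    refine Quaternion.ext _ _ ?_ ?_ ?_ ?_ <;>
      simp [Quaternion.re_one, Quaternion.imI_one, Quaternion.imJ_one, Quaternion.imK_one]
    ring
  have hP : (P : Quaternion ℝ) * star (P : Quaternion ℝ) = 1 := P.2.2
  -- The quadratic equation of a unit quaternion; it reproduces the recurrence of the `U`
  -- polynomials. The induction starts from `U₋₁ = 0`, `U₋₂ = -1`.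
  have hP2 : (P : Quaternion ℝ) * P = (2 * (P : Quaternion ℝ).re) • (P : Quaternion ℝ) - 1 := by
    rw [hs, mul_sub, mul_smul_comm, mul_one] at hP
    rw [← hP]; abel
  induction ℓ using Int.induction_on with
  | zero =>
    rw [zero_sub, zero_sub, U_neg_one, U_neg_two]
    simp
  | succ n ih =>
    rw [zpow_add_one]
    change ((P ^ (n : ℤ) : SU2) : Quaternion ℝ) * (P : Quaternion ℝ) = _
    rw [ih, sub_mul, smul_mul_assoc, hP2, smul_mul_assoc, one_mul]
    have e := congrArg (eval (P : Quaternion ℝ).re) (U_eq ℝ (n : ℤ))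
    rw [show (n : ℤ) + 1 - 1 = n by ring, show (n : ℤ) + 1 - 2 = n - 1 by ring, e]
    simp only [eval_sub, eval_mul, eval_X, eval_ofNat]
    module
  | pred n ih =>
    rw [zpow_sub_one]
    change ((P ^ (-n : ℤ) : SU2) : Quaternion ℝ) * star (P : Quaternion ℝ) = _
    rw [ih, sub_mul, smul_mul_assoc, hP, smul_mul_assoc, one_mul, hs]
    have e := congrArg (eval (P : Quaternion ℝ).re) (U_eq ℝ (-n - 1 : ℤ))
    rw [show (-n : ℤ) - 1 - 1 = -n - 2 by ring] at *
    rw [e, show (-n : ℤ) - 1 - 2 = -n - 3 by ring] at *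
    simp only [eval_sub, eval_mul, eval_X, eval_ofNat]
    module

/-- The conjugating element `(X₁ X₂) ^ ℓ`, as a polynomial function of the pair. -/
def braidMul (ℓ : ℤ) (X : Quaternion ℝ × Quaternion ℝ) : Quaternion ℝ :=
  (U ℝ (ℓ - 1)).eval (X.1 * X.2).re • (X.1 * X.2) - (U ℝ (ℓ - 2)).eval (X.1 * X.2).re • 1

/-- The action of `σ₁ ^ (2 ℓ)`, extended to pairs of quaternions. -/
def braidMap (ℓ : ℤ) (X : Quaternion ℝ × Quaternion ℝ) : Quaternion ℝ × Quaternion ℝ :=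
  (braidMul ℓ X * X.1 * star (braidMul ℓ X), braidMul ℓ X * X.2 * star (braidMul ℓ X))

theorem braidMul_emb (ℓ : ℤ) (X : SU2 × SU2) :
    braidMul ℓ (emb₂ X) = ((X.1 * X.2) ^ ℓ : SU2) := (coe_zpow (X.1 * X.2) ℓ).symm

theorem emb_sigmaOne_zpow (ℓ : ℤ) (X : SU2 × SU2) :
    emb₂ ((sigmaOne ^ (2 * ℓ)) X) = braidMap ℓ (emb₂ X) := by
  rw [sigmaOne_zpow_apply, braidMap, braidMul_emb]
  rfl

/-- If the conjugating element is real, it is `±1`, and the Chebyshev polynomials take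
known values. -/
theorem chebyshev_of_eval_eq_zero {ℓ : ℤ} {τ s : ℝ} (ha : (U ℝ (ℓ - 1)).eval τ = 0)
    (hb : -(U ℝ (ℓ - 2)).eval τ = s) :
    (1 - τ ^ 2) * (derivative (U ℝ (ℓ - 1))).eval τ = -ℓ * s ∧
      (derivative (U ℝ (ℓ - 2))).eval τ = τ * (derivative (U ℝ (ℓ - 1))).eval τ := by
  have hT : T ℝ ℓ = X * U ℝ (ℓ - 1) - U ℝ (ℓ - 2) := by
    have := T_eq_X_mul_U_sub_U ℝ (ℓ - 2)
    rwa [show ℓ - 2 + 2 = ℓ by ring, show ℓ - 2 + 1 = ℓ - 1 by ring] at this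
  have hTs : (T ℝ ℓ).eval τ = s := by
    rw [hT]
    simp only [eval_sub, eval_mul, eval_X, ha]
    rw [← hb]; ring
  constructor
  -- At `τ` the identity `ℓ T_ℓ = X U_{ℓ-1} - (1 - X²) U'_{ℓ-1}` loses its `U_{ℓ-1}` term, and
  -- `T_ℓ(τ) = s`.
  · have := congrArg (eval τ) (add_one_mul_T_eq_poly_in_U (R := ℝ) (ℓ - 1))
    rw [show ℓ - 1 + 1 = ℓ by ring] at this
    simp only [eval_sub, eval_mul, eval_X, ha, hTs, eval_add, eval_pow, eval_one] at this
    simp at this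
    linarith
  -- Here `T'_ℓ = ℓ U_{ℓ-1}` vanishes at `τ`; the other side is the derivative of `X U_{ℓ-1} -
  -- U_{ℓ-2}`.
  · have := congrArg (eval τ) (T_derivative_eq_U (R := ℝ) ℓ)
    rw [hT] at this
    simp only [derivative_sub, derivative_mul, derivative_X, one_mul, eval_sub, eval_add, eval_mul,
      eval_X, ha, mul_zero, zero_add] at this
    linarith

end Braid

/-! ### Smooth curves in conjugacy classes -/

section Curves

instance : StarModule ℝ (Quaternion ℝ) := ⟨fun r q => by ext <;> simp⟩

/-- The real part as a continuous linear map. -/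
def reL : Quaternion ℝ →L[ℝ] ℝ :=
  LinearMap.toContinuousLinearMap
    { toFun := fun q => q.re, map_add' := fun _ _ => rfl, map_smul' := fun _ _ => rfl }

theorem hasDerivAt_re {c : ℝ → Quaternion ℝ} {v : Quaternion ℝ} {t : ℝ}
    (h : HasDerivAt c v t) : HasDerivAt (fun t => (c t).re) v.re t :=
  reL.hasFDerivAt.comp_hasDerivAt t h

theorem contDiffAt_re {E : Type*} [NormedAddCommGroup E] [NormedSpace ℝ E]
    {c : E → Quaternion ℝ} {t : E} (h : ContDiffAt ℝ ∞ c t) : ContDiffAt ℝ ∞ (fun t => (c t).re) t :=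
  reL.contDiff.contDiffAt.comp t h

theorem contDiffAt_quaternion_star {E : Type*} [NormedAddCommGroup E] [NormedSpace ℝ E]
    {c : E → Quaternion ℝ} {t : E} (h : ContDiffAt ℝ ∞ c t) :
    ContDiffAt ℝ ∞ (fun t => star (c t)) t :=
  (starL' ℝ : Quaternion ℝ ≃L[ℝ] Quaternion ℝ).contDiff.contDiffAt.comp t h

theorem unit_re_sq_add_dot {x : Quaternion ℝ} (hx : x ∈ unitary (Quaternion ℝ)) :
    x.re ^ 2 + dot x x = 1 := by
  have := congrArg QuaternionAlgebra.re hx.2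
  rw [Quaternion.re_one] at this
  simp at this
  simp only [dot]
  linarith

/-- Velocities of curves in a conjugacy class are tangent to the sphere. -/
theorem velocity_mem_sphereTangent {α : ℝ} {c : ℝ → Quaternion ℝ} {x v : Quaternion ℝ}
    (hc : ∀ᶠ t in 𝓝 0, c t ∈ (fun Z : SU2 => (Z : Quaternion ℝ)) '' conjClass α) (h0 : c 0 = x)
    (h : HasDerivAt c v 0) : v ∈ sphereTangent x := by
  have h1 : v.re = 0 := by
    refine (hasDerivAt_re h).unique ((hasDerivAt_const (0 : ℝ) (Real.cos α)).congr_of_eventuallyEq ?_)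
    filter_upwards [hc] with t ht
    obtain ⟨Z, hZ, hZt⟩ := ht
    rw [← hZt]
    exact hZ
  refine ⟨h1, ?_⟩
  have h2 : v * star x + x * star v = 0 := by
    have := h.mul h.star
    rw [h0] at this
    refine this.unique ((hasDerivAt_const (0 : ℝ) (1 : Quaternion ℝ)).congr_of_eventuallyEq ?_)
    filter_upwards [hc] with t ht
    obtain ⟨Z, -, hZt⟩ := ht
    change c t * star (c t) = 1
    rw [← hZt]
    exact Z.2.2
  have h3 := congrArg QuaternionAlgebra.re h2
  rw [Quaternion.re_zero] at h3
  simp [h1] at h3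
  simp only [dot]
  linarith

/-- Every vector tangent to the sphere is the velocity of a smooth curve in the conjugacy class. -/
theorem exists_curve {α : ℝ} {x : SU2} (hx : x ∈ conjClass α)
    (hx0 : 0 < dot (x : Quaternion ℝ) x) {v : Quaternion ℝ}
    (hv : v ∈ sphereTangent (x : Quaternion ℝ)) :
    ∃ c : ℝ → SU2, (∀ t, c t ∈ conjClass α) ∧ c 0 = x ∧
      ContDiff ℝ ∞ (fun t => (c t : Quaternion ℝ)) ∧
      HasDerivAt (fun t => (c t : Quaternion ℝ)) v 0 := by
  set y : Quaternion ℝ := x.1 with hy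
  -- Chosen so that `q y - y q = v`. Conjugating `y` by `1 + t q` and dividing by its squared norm
  -- `n t` gives a rational curve in the conjugacy class with this velocity.
  set q : Quaternion ℝ := (2 * dot y y)⁻¹ • cross y v with hq
  have hqr : q.re = 0 := by rw [hq]; simp
  have hqs : star q = -q := by
    refine Quaternion.ext _ _ ?_ ?_ ?_ ?_ <;> simp [hqr]
  set n : ℝ → ℝ := fun t => 1 + t ^ 2 * dot q q with hn
  have hnpos : ∀ t, 0 < n t := fun t => by
    have := dot_self_nonneg q
    simp only [hn]; positivity
  set g : ℝ → Quaternion ℝ := fun t => 1 + t • q with hg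
  have hgs : ∀ t, star (g t) = 1 - t • q := fun t => by
    refine Quaternion.ext _ _ ?_ ?_ ?_ ?_ <;> simp [hg, hqr,
      Quaternion.re_one, Quaternion.imI_one, Quaternion.imJ_one, Quaternion.imK_one]
  have hgg : ∀ t, star (g t) * g t = n t • (1 : Quaternion ℝ) := fun t => by
    rw [hgs]
    refine Quaternion.ext _ _ ?_ ?_ ?_ ?_ <;> simp [hg, hn, hqr, dot,
      Quaternion.re_one, Quaternion.imI_one, Quaternion.imJ_one, Quaternion.imK_one] <;> ring
  have hgg' : ∀ t, g t * star (g t) = n t • (1 : Quaternion ℝ) := fun t => by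
    rw [hgs]
    refine Quaternion.ext _ _ ?_ ?_ ?_ ?_ <;> simp [hg, hn, hqr, dot,
      Quaternion.re_one, Quaternion.imI_one, Quaternion.imJ_one, Quaternion.imK_one] <;> ring
  set c : ℝ → Quaternion ℝ := fun t => (n t)⁻¹ • (g t * y * star (g t)) with hcdef
  have hcu : ∀ t, c t ∈ unitary (Quaternion ℝ) := fun t => by
    have hne := (hnpos t).ne'
    have hy1 := x.2.1
    have hy2 := x.2.2
    have hss : star (c t) = (n t)⁻¹ • (g t * star y * star (g t)) := by
      rw [hcdef]
      simp only [Quaternion.star_smul, star_mul, star_star, mul_assoc]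
    rw [Unitary.mem_iff, hss]
    simp only [hcdef, smul_mul_smul_comm]
    constructor
    · have : g t * star y * star (g t) * (g t * y * star (g t)) = (n t * n t) • 1 := by
        calc _ = g t * star y * (star (g t) * g t) * y * star (g t) := by noncomm_ring
          _ = n t • (g t * (star y * y) * star (g t)) := by
            rw [hgg, mul_smul_comm, smul_mul_assoc, smul_mul_assoc, mul_one, mul_assoc (g t)]
          _ = _ := by rw [hy1, mul_one, hgg', smul_smul]
      rw [this, smul_smul]
      field_simp
      simp
    · have : g t * y * star (g t) * (g t * star y * star (g t)) = (n t * n t) • 1 := by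
        calc _ = g t * y * (star (g t) * g t) * star y * star (g t) := by noncomm_ring
          _ = n t • (g t * (y * star y) * star (g t)) := by
            rw [hgg, mul_smul_comm, smul_mul_assoc, smul_mul_assoc, mul_one, mul_assoc (g t)]
          _ = _ := by rw [hy2, mul_one, hgg', smul_smul]
      rw [this, smul_smul]
      field_simp
      simp
  have hcsm : ContDiff ℝ ∞ c := by
    have h1 : ContDiff ℝ ∞ n := by fun_prop
    have h2 : ContDiff ℝ ∞ g := by fun_prop
    have h3 : ContDiff ℝ ∞ (fun t => star (g t)) := by
      simp only [hgs]; fun_prop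
    exact (h1.inv fun t => (hnpos t).ne').smul ((h2.mul contDiff_const).mul h3)
  refine ⟨fun t => ⟨c t, hcu t⟩, fun t => ?_, ?_, hcsm, ?_⟩
  · change (c t).re = Real.cos α
    rw [← (hx : (x : Quaternion ℝ).re = Real.cos α)]
    have hre : (g t * y * star (g t)).re = (star (g t) * g t * y).re := by
      generalize g t = h
      simp
      ring
    simp only [hcdef, Quaternion.re_smul, hre, hgg, smul_mul_assoc, one_mul, smul_eq_mul]
    rw [← mul_assoc, inv_mul_cancel₀ (hnpos t).ne', one_mul]
  · apply Subtype.ext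
    change c 0 = y
    simp [hcdef, hn, hg]
  · change HasDerivAt c v 0
    have h1 : HasDerivAt n 0 0 := by
      have := ((hasDerivAt_pow 2 (0 : ℝ)).mul_const (dot q q)).const_add 1
      exact HasDerivAt.congr_deriv this (by simp)
    have h2 : HasDerivAt g q 0 := by
      have := ((hasDerivAt_id (0 : ℝ)).smul_const q).const_add 1
      exact HasDerivAt.congr_deriv this (by simp)
    have h3 := (h1.inv (hnpos 0).ne').smul ((h2.mul_const y).mul h2.star)
    refine HasDerivAt.congr_deriv (f := c) h3 ?_
    have hn0 : n 0 = 1 := by simp [hn]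
    have hg0 : g 0 = 1 := by simp [hg]
    have hqy : v = q * y - y * q := by
      have key : cross y v * y - y * cross y v = (2 * dot y y) • v - (2 * dot y v) • y.im := by
        refine Quaternion.ext _ _ ?_ ?_ ?_ ?_ <;> simp [dot, hv.1] <;> ring
      rw [hv.2, mul_zero, zero_smul, sub_zero] at key
      rw [hq, smul_mul_assoc, mul_smul_comm, ← smul_sub, key, smul_smul,
        inv_mul_cancel₀ (by positivity), one_smul]
    change (n 0)⁻¹ • (q * y * star (g 0) + g 0 * y * star q) +
      (-0 / n 0 ^ 2) • (g 0 * y * star (g 0)) = v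
    simp only [hn0, hg0, hqs, star_one, mul_one, one_mul, neg_zero, zero_div, zero_smul,
      inv_one, one_smul, add_zero, mul_neg]
    rw [hqy]
    abel

end Curves

/-! ### The derivative of the braid action at a fixed point -/

section TangentSpaces

open Polynomial Polynomial.Chebyshev

/-- A unit quaternion which commutes with two non-commuting quaternions is `±1`. -/
theorem eq_real_of_commute {x y q : Quaternion ℝ} (hc : 0 < dot (cross x y) (cross x y))
    (hq : q ∈ unitary (Quaternion ℝ)) (hx : q * x = x * q) (hy : q * y = y * q) :
    q = q.re • (1 : Quaternion ℝ) ∧ q.re ^ 2 = 1 := by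
  have cr : ∀ z, q * z - z * q = (2 : ℝ) • cross q z := fun z => by
    refine Quaternion.ext _ _ ?_ ?_ ?_ ?_ <;> simp <;> ring
  have h1 : cross q x = 0 := by
    have := cr x
    rw [hx, sub_self] at this
    exact (smul_eq_zero.1 this.symm).resolve_left two_ne_zero
  have h2 : cross q y = 0 := by
    have := cr y
    rw [hy, sub_self] at this
    exact (smul_eq_zero.1 this.symm).resolve_left two_ne_zero
  -- An identity recovering `Im q` from `q × x` and `q × y`, both zero here; the last term only
  -- removes the real parts of `x` and `y`.
  have key : dot (cross x y) (cross x y) • q.im = dot (cross x y) (cross q y) • x -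
      dot (cross x y) (cross q x) • y + dot y (cross q x) • cross x y -
      (dot (cross x y) (cross q y) * x.re - dot (cross x y) (cross q x) * y.re) • 1 := by
    refine Quaternion.ext _ _ ?_ ?_ ?_ ?_ <;>
      simp [dot, Quaternion.re_one, Quaternion.imI_one, Quaternion.imJ_one, Quaternion.imK_one] <;>
      ring
  have him : q.im = 0 := by
    rw [h1, h2] at key
    simp only [dot_zero, zero_smul, zero_mul, sub_zero, add_zero] at key
    exact (smul_eq_zero.1 key).resolve_left hc.ne'
  have e1 : q.imI = 0 := congrArg QuaternionAlgebra.imI him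
  have e2 : q.imJ = 0 := congrArg QuaternionAlgebra.imJ him
  have e3 : q.imK = 0 := congrArg QuaternionAlgebra.imK him
  constructor
  · refine Quaternion.ext _ _ ?_ ?_ ?_ ?_ <;>
      simp [e1, e2, e3, Quaternion.re_one, Quaternion.imI_one, Quaternion.imJ_one,
        Quaternion.imK_one]
  · have := unit_re_sq_add_dot hq
    simpa [dot, e1, e2, e3] using this

/-- The coefficient in the derivative of `σ₁ ^ (2 ℓ)` at a fixed point. -/
def twist (x y : Quaternion ℝ) (ℓ : ℤ) : ℝ := -ℓ / (1 - (x * y).re ^ 2)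

theorem dot_cross_mul (x y : Quaternion ℝ) :
    dot (cross x y) (x * y) = dot (cross x y) (cross x y) := by
  simp [dot]; ring

/-- The quantity is `|Im P|²`, and `Im P ≠ 0` because its scalar product with `x × y` is `|x × y|² >
0`. -/
theorem one_sub_re_sq_pos {x y : Quaternion ℝ} (hx : x ∈ unitary (Quaternion ℝ))
    (hy : y ∈ unitary (Quaternion ℝ)) (hc : 0 < dot (cross x y) (cross x y)) :
    0 < 1 - (x * y).re ^ 2 := by
  have hn := unit_re_sq_add_dot (mul_mem hx hy : x * y ∈ unitary (Quaternion ℝ))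
  rw [show 1 - (x * y).re ^ 2 = dot (x * y) (x * y) by linarith]
  refine (dot_self_nonneg _).lt_of_ne' fun h => ?_
  have h1 : (x * y).im = 0 := eq_zero_of_dot_self (by simp) (by simpa [dot] using h)
  have h2 := dot_cross_mul x y
  have h3 : dot (cross x y) (x * y) = dot (cross x y) (x * y).im := by simp only [dot]; rfl
  rw [h3, h1, dot_zero] at h2
  exact hc.ne h2

/-- At the fixed point the conjugating element `Q` is the real number `s`, and its derivative `A m
(P - τ)` is imaginary, where `A = U'_{ℓ-1}(τ)` and `m = Re(dμ v)`. The product rule for `Q Z Q̄`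
then gives `Z' + s A m (P Z - Z P)`, and `s A` is `twist`. -/
theorem hasDerivAt_braidMap {x y : Quaternion ℝ} (hx : x ∈ unitary (Quaternion ℝ))
    (hy : y ∈ unitary (Quaternion ℝ)) (hc : 0 < dot (cross x y) (cross x y)) {ℓ : ℤ} {s : ℝ}
    (hQ : braidMul ℓ (x, y) = s • (1 : Quaternion ℝ)) (hs : s ^ 2 = 1)
    {X : ℝ → Quaternion ℝ × Quaternion ℝ} {v : Quaternion ℝ × Quaternion ℝ} (h0 : X 0 = (x, y))
    (h : HasDerivAt X v 0) : HasDerivAt (fun t => braidMap ℓ (X t))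
      (v + (twist x y ℓ * (mulDeriv x y v).re) • orbitMap x y (x * y)) 0 := by
  set τ := (x * y).re with hτ
  have h1 : HasDerivAt (fun t => (X t).1) v.1 0 := h.fst
  have h2 : HasDerivAt (fun t => (X t).2) v.2 0 := h.snd
  have hX1 : (X 0).1 = x := by rw [h0]
  have hX2 : (X 0).2 = y := by rw [h0]
  have hP : HasDerivAt (fun t => (X t).1 * (X t).2) (mulDeriv x y v) 0 := by
    have := h1.mul h2
    rw [hX1, hX2] at this
    exact this
  have hre := hasDerivAt_re hP
  have hpoly : ∀ p : ℝ[X], HasDerivAt (fun t => p.eval ((X t).1 * (X t).2).re)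
      ((derivative p).eval τ * (mulDeriv x y v).re) 0 := by
    intro p
    have := (p.hasDerivAt ((X 0).1 * (X 0).2).re).comp 0 hre
    rw [hX1, hX2] at this
    exact this
  -- `Q = U_{ℓ-1}(τ) P - U_{ℓ-2}(τ)` is real, but `P` has a non-zero component along `x × y`.
  have ha : (U ℝ (ℓ - 1)).eval τ = 0 := by
    have h3 : dot (cross x y) (braidMul ℓ (x, y)) =
        (U ℝ (ℓ - 1)).eval τ * dot (cross x y) (x * y) := by
      simp only [braidMul, ← hτ, dot, Quaternion.imI_sub, Quaternion.imJ_sub, Quaternion.imK_sub,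
        Quaternion.imI_smul, Quaternion.imJ_smul, Quaternion.imK_smul, Quaternion.imI_one,
        Quaternion.imJ_one, Quaternion.imK_one, smul_eq_mul]
      ring
    have h4 : dot (cross x y) (s • (1 : Quaternion ℝ)) = 0 := by
      simp only [dot, Quaternion.imI_smul, Quaternion.imJ_smul, Quaternion.imK_smul,
        Quaternion.imI_one, Quaternion.imJ_one, Quaternion.imK_one, smul_eq_mul]
      ring
    rw [hQ, h4, dot_cross_mul] at h3
    exact (mul_eq_zero.1 h3.symm).resolve_right hc.ne'
  have hb : -(U ℝ (ℓ - 2)).eval τ = s := by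
    have h3 := congrArg QuaternionAlgebra.re hQ
    simp only [braidMul, ← hτ, ha, zero_smul, zero_sub, Quaternion.re_neg, Quaternion.re_smul,
      Quaternion.re_one, smul_eq_mul, mul_one] at h3
    exact h3
  obtain ⟨hA, hB⟩ := chebyshev_of_eval_eq_zero ha hb
  set A := (derivative (U ℝ (ℓ - 1))).eval τ with hAdef
  set m := (mulDeriv x y v).re with hm
  have hQ' : HasDerivAt (fun t => braidMul ℓ (X t)) ((A * m) • (x * y - τ • (1 : Quaternion ℝ))) 0 := by
    have h3 := ((hpoly (U ℝ (ℓ - 1))).smul hP).sub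
      ((hpoly (U ℝ (ℓ - 2))).smul_const (1 : Quaternion ℝ))
    refine HasDerivAt.congr_deriv h3 ?_
    rw [hX1, hX2, ← hτ, ha, hB]
    module
  have hsA : s * A = twist x y ℓ := by
    rw [twist, eq_div_iff (one_sub_re_sq_pos hx hy hc).ne', ← hτ]
    linear_combination s * hA - (ℓ : ℝ) * hs
  have hQ0 : braidMul ℓ (X 0) = s • (1 : Quaternion ℝ) := by rw [h0, hQ]
  have hstar : star (x * y - τ • (1 : Quaternion ℝ)) = -(x * y - τ • (1 : Quaternion ℝ)) := by
    rw [hτ]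
    refine Quaternion.ext _ _ ?_ ?_ ?_ ?_ <;>
      simp [Quaternion.re_one, Quaternion.imI_one, Quaternion.imJ_one, Quaternion.imK_one] <;> ring
  have hcomp : ∀ (Z : ℝ → Quaternion ℝ) (w : Quaternion ℝ), HasDerivAt Z w 0 →
      HasDerivAt (fun t => braidMul ℓ (X t) * Z t * star (braidMul ℓ (X t)))
        (w + (twist x y ℓ * m) • (x * y * Z 0 - Z 0 * (x * y))) 0 := by
    intro Z w hZ
    have h3 := (hQ'.mul hZ).mul hQ'.star
    refine HasDerivAt.congr_deriv h3 ?_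
    simp only [Pi.mul_apply]
    rw [hQ0, ← hsA]
    have hss : star (s • (1 : Quaternion ℝ)) = s • (1 : Quaternion ℝ) := by simp
    have hs2 : star ((A * m) • (x * y - τ • (1 : Quaternion ℝ))) =
        -((A * m) • (x * y - τ • (1 : Quaternion ℝ))) := by
      rw [Quaternion.star_smul, hstar, smul_neg]
    rw [hss, hs2]
    simp only [smul_mul_assoc, mul_smul_comm, one_mul, mul_one, sub_mul, mul_sub, mul_neg,
      smul_sub, smul_add, smul_smul]
    have hw : (s * s) • w = w := by rw [← pow_two, hs, one_smul]
    rw [hw]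
    module
  have r1 := hcomp _ _ h1
  have r2 := hcomp _ _ h2
  rw [hX1] at r1
  rw [hX2] at r2
  exact r1.prodMk r2

theorem contDiff_braidMap (ℓ : ℤ) : ContDiff ℝ ∞ (braidMap ℓ) := by
  rw [contDiff_iff_contDiffAt]
  intro X
  have h1 : ContDiffAt ℝ ∞ (fun X : Quaternion ℝ × Quaternion ℝ => X.1) X := contDiffAt_fst
  have h2 : ContDiffAt ℝ ∞ (fun X : Quaternion ℝ × Quaternion ℝ => X.2) X := contDiffAt_snd
  have h3 := contDiffAt_re (h1.mul h2)
  have hpoly : ∀ p : ℝ[X], ContDiffAt ℝ ∞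
      (fun X : Quaternion ℝ × Quaternion ℝ => p.eval (X.1 * X.2).re) X :=
    fun p => (show ContDiff ℝ ∞ (fun x => p.eval x) by simpa using p.contDiff_aeval (𝕜 := ℝ) (n := ∞)).contDiffAt.comp X h3
  have hQ : ContDiffAt ℝ ∞ (braidMul ℓ) X :=
    ((hpoly _).smul (h1.mul h2)).sub ((hpoly _).smul contDiffAt_const)
  have hQs := contDiffAt_quaternion_star hQ
  exact ((hQ.mul h1).mul hQs).prodMk ((hQ.mul h2).mul hQs)

end TangentSpaces

/-! ### Tangent spaces of `Γ_β`, `Λ₂` and `H₂` at an intersection point -/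

section Points

theorem tangentSpace_mono {V : Type*} [NormedAddCommGroup V] [NormedSpace ℝ V] {S S' : Set V}
    (h : S ⊆ S') (p : V) : tangentSpace S p ≤ tangentSpace S' p := by
  refine Submodule.span_mono ?_
  rintro v ⟨c, h1, h2, h3⟩
  exact ⟨c, h1, h2.mono fun t ht => h ht, h3⟩

theorem hasDerivAt_of_contDiffAt {V : Type*} [NormedAddCommGroup V] [NormedSpace ℝ V] {c : ℝ → V}
    {v : V} (h : ContDiffAt ℝ ∞ c 0) (hv : deriv c 0 = v) : HasDerivAt c v 0 :=
  hv ▸ (h.differentiableAt (by simp)).hasDerivAt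

theorem tangentSpace_conjClass {α : ℝ} {x : SU2} (hx : x ∈ conjClass α)
    (hx0 : 0 < dot (x : Quaternion ℝ) (x : Quaternion ℝ)) :
    tangentSpace ((fun Z : SU2 => (Z : Quaternion ℝ)) '' conjClass α) (x : Quaternion ℝ) =
      sphereTangent (x : Quaternion ℝ) := by
  apply le_antisymm
  · refine Submodule.span_le.2 ?_
    rintro v ⟨c, h1, h2, h3, h4⟩
    exact velocity_mem_sphereTangent h2 h3 (hasDerivAt_of_contDiffAt h1 h4)
  · intro v hv
    obtain ⟨c, h1, h2, h3, h4⟩ := exists_curve hx hx0 hv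
    refine Submodule.subset_span ⟨fun t => (c t : Quaternion ℝ), h3.contDiffAt,
      .of_forall fun t => ⟨c t, h1 t, rfl⟩, by simp only [h2], h4.deriv⟩

/-- The velocity of a curve of quadruples whose first two entries lie in given conjugacy classes. -/
theorem velocity_fst_mem {α₁ α₂ : ℝ} {c : ℝ → Quaternion ℝ × Quaternion ℝ} {X : SU2 × SU2}
    {v : Quaternion ℝ × Quaternion ℝ} (hc : ∀ᶠ t in 𝓝 0, c t ∈ emb₂ '' R α₁ α₂)
    (h0 : c 0 = emb₂ X) (h : HasDerivAt c v 0) :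
    v ∈ pairTangent (X.1 : Quaternion ℝ) (X.2 : Quaternion ℝ) := by
  constructor
  · refine velocity_mem_sphereTangent (α := α₁) ?_ (by rw [h0]; rfl) h.fst
    filter_upwards [hc] with t ⟨Z, hZ, hZt⟩
    exact ⟨Z.1, hZ.1, by rw [← hZt]; rfl⟩
  · refine velocity_mem_sphereTangent (α := α₂) ?_ (by rw [h0]; rfl) h.snd
    filter_upwards [hc] with t ⟨Z, hZ, hZt⟩
    exact ⟨Z.2, hZ.2, by rw [← hZt]; rfl⟩

variable {α₁ α₂ : ℝ} {X : SU2 × SU2}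

/-- The conjugating element at a fixed point of the braid is `±1`. -/
theorem exists_sign_of_fixed {ℓ : ℤ} {x y : SU2}
    (hc : 0 < dot (cross (x : Quaternion ℝ) (y : Quaternion ℝ))
      (cross (x : Quaternion ℝ) (y : Quaternion ℝ)))
    (h : (sigmaOne ^ (2 * ℓ)) (x, y) = (x, y)) :
    ∃ s : ℝ, braidMul ℓ ((x : Quaternion ℝ), (y : Quaternion ℝ)) = s • (1 : Quaternion ℝ) ∧
      s ^ 2 = 1 := by
  rw [sigmaOne_zpow_apply] at h
  have h1 := mul_inv_eq_iff_eq_mul.1 (congrArg Prod.fst h)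
  have h2 := mul_inv_eq_iff_eq_mul.1 (congrArg Prod.snd h)
  have e : braidMul ℓ ((x : Quaternion ℝ), (y : Quaternion ℝ)) =
      (((x * y) ^ ℓ : SU2) : Quaternion ℝ) := braidMul_emb ℓ (x, y)
  obtain ⟨h3, h4⟩ := eq_real_of_commute hc ((x * y) ^ ℓ : SU2).2
    (congrArg Subtype.val h1) (congrArg Subtype.val h2)
  exact ⟨_, e.trans h3, h4⟩

/-- The second half of a curve in `Γ_β` is `braidMap` of the first, so its velocity is prescribed.
Conversely, curves in the two spheres lift to the graph through `braidMap`. -/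
theorem tangentQuad_Gam {ℓ : ℤ} {x y : SU2} (hX : (x, y) ∈ R α₁ α₂)
    (hc : 0 < dot (cross (x : Quaternion ℝ) (y : Quaternion ℝ))
      (cross (x : Quaternion ℝ) (y : Quaternion ℝ)))
    (h : (sigmaOne ^ (2 * ℓ)) (x, y) = (x, y)) :
    tangentQuad (Gam α₁ α₂ (sigmaOne ^ (2 * ℓ))) ((x, y), (x, y)) =
      graphTangent (x : Quaternion ℝ) (y : Quaternion ℝ)
        (twist (x : Quaternion ℝ) (y : Quaternion ℝ) ℓ) := by
  obtain ⟨s, hQ, hs⟩ := exists_sign_of_fixed hc h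
  apply le_antisymm
  · refine Submodule.span_le.2 ?_
    rintro v ⟨c, h1, h2, h3, h4⟩
    have hd := hasDerivAt_of_contDiffAt h1 h4
    have hm : v.1 ∈ pairTangent (x : Quaternion ℝ) (y : Quaternion ℝ) := by
      refine velocity_fst_mem (α₁ := α₁) (α₂ := α₂) (X := (x, y)) ?_ (by rw [h3]; rfl) hd.fst
      filter_upwards [h2] with t ⟨Z, hZ, hZt⟩
      exact ⟨Z.1, hZ.1, by rw [← hZt]; rfl⟩
    refine ⟨v.1, hm, ?_⟩
    rw [graphMap_apply]
    refine Prod.ext rfl ?_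
    have hb := hasDerivAt_braidMap x.2 y.2 hc hQ hs (X := fun t => (c t).1)
      (by rw [h3]; rfl) hd.fst
    refine (hb.congr_of_eventuallyEq ?_).unique hd.snd
    filter_upwards [h2] with t ⟨Z, hZ, hZt⟩
    rw [← hZt]
    change emb₂ Z.2 = braidMap ℓ (emb₂ Z.1)
    rw [hZ.2, emb_sigmaOne_zpow]
  · rintro _ ⟨v, hv, rfl⟩
    obtain ⟨c₁, h1, h2, h3, h4⟩ := exists_curve hX.1 (dot_self_pos_left hc) hv.1
    obtain ⟨c₂, k1, k2, k3, k4⟩ := exists_curve hX.2 (dot_self_pos_right hc) hv.2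
    have hb := hasDerivAt_braidMap x.2 y.2 hc hQ hs
      (X := fun t => ((c₁ t : Quaternion ℝ), (c₂ t : Quaternion ℝ)))
      (by simp only [h2, k2]) (h4.prodMk k4)
    have hsm : ContDiff ℝ ∞ (fun t => ((c₁ t : Quaternion ℝ), (c₂ t : Quaternion ℝ))) :=
      h3.prodMk k3
    refine Submodule.subset_span ⟨fun t => (((c₁ t : Quaternion ℝ), (c₂ t : Quaternion ℝ)),
      braidMap ℓ ((c₁ t : Quaternion ℝ), (c₂ t : Quaternion ℝ))),
      (hsm.prodMk ((contDiff_braidMap ℓ).comp hsm)).contDiffAt, .of_forall fun t => ?_, ?_,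
      ((h4.prodMk k4).prodMk hb).deriv⟩
    · refine ⟨((c₁ t, c₂ t), (sigmaOne ^ (2 * ℓ)) (c₁ t, c₂ t)), ⟨⟨h1 t, k1 t⟩, rfl⟩, ?_⟩
      change (_, _) = _
      rw [emb_sigmaOne_zpow]
      rfl
    · simp only [h2, k2]
      change (_, braidMap ℓ (emb₂ (x, y))) = _
      rw [← emb_sigmaOne_zpow, h]
      rfl

/-- The diagonal is the graph of the trivial braid, so its tangent space is the case `κ = 0`. -/
theorem Lam_eq_Gam (α₁ α₂ : ℝ) : Lam α₁ α₂ = Gam α₁ α₂ (sigmaOne ^ (2 * (0 : ℤ))) := by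
  rw [mul_zero, zpow_zero]
  rfl

theorem tangentQuad_Lam {x y : SU2} (hX : (x, y) ∈ R α₁ α₂)
    (hc : 0 < dot (cross (x : Quaternion ℝ) (y : Quaternion ℝ))
      (cross (x : Quaternion ℝ) (y : Quaternion ℝ))) :
    tangentQuad (Lam α₁ α₂) ((x, y), (x, y)) =
      graphTangent (x : Quaternion ℝ) (y : Quaternion ℝ) 0 := by
  rw [Lam_eq_Gam, tangentQuad_Gam hX hc (by simp)]
  simp [twist]

theorem conj_mem_conjClass {α : ℝ} {g z : SU2} (hz : z ∈ conjClass α) :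
    g * z * g⁻¹ ∈ conjClass α := by
  change ((g : Quaternion ℝ) * (z : Quaternion ℝ) * star (g : Quaternion ℝ)).re = Real.cos α
  rw [← (hz : (z : Quaternion ℝ).re = Real.cos α)]
  have h3 := unit_re_sq_add_dot g.2
  have : ((g : Quaternion ℝ) * (z : Quaternion ℝ) * star (g : Quaternion ℝ)).re =
      ((g : Quaternion ℝ).re ^ 2 + dot (g : Quaternion ℝ) (g : Quaternion ℝ)) *
        (z : Quaternion ℝ).re := by
    simp [dot]; ring
  rw [this, h3, one_mul]

/-- Conjugation by a power of `X₁ X₂` fixes `X₁ X₂`. -/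
theorem Gam_subset_H (ℓ : ℤ) : Gam α₁ α₂ (sigmaOne ^ (2 * ℓ)) ⊆ H α₁ α₂ := by
  rintro ⟨X, Y⟩ ⟨h1, h2⟩
  simp only at h1 h2
  rw [sigmaOne_zpow_apply] at h2
  subst h2
  refine ⟨h1, ⟨conj_mem_conjClass h1.1, conj_mem_conjClass h1.2⟩, ?_⟩
  simp only
  have : (X.1 * X.2) ^ ℓ * (X.1 * X.2) = X.1 * X.2 * (X.1 * X.2) ^ ℓ :=
    ((Commute.refl (X.1 * X.2)).zpow_left ℓ).eq
  calc X.1 * X.2 = X.1 * X.2 * (X.1 * X.2) ^ ℓ * ((X.1 * X.2) ^ ℓ)⁻¹ := by group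
    _ = _ := by rw [← this]; group

/-- Differentiating the equations bounds the tangent space from above. No implicit function theorem
is needed for the lower bound: `Λ₂` and `Γ_β` lie in `H₂`, and for `ℓ ≠ 0` their tangent spaces
already span `levelTangent`. -/
theorem tangentQuad_H {ℓ : ℤ} (hℓ : ℓ ≠ 0) {x y : SU2} (hX : (x, y) ∈ R α₁ α₂)
    (hc : 0 < dot (cross (x : Quaternion ℝ) (y : Quaternion ℝ))
      (cross (x : Quaternion ℝ) (y : Quaternion ℝ)))
    (h : (sigmaOne ^ (2 * ℓ)) (x, y) = (x, y)) :
    tangentQuad (H α₁ α₂) ((x, y), (x, y)) =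
      levelTangent (x : Quaternion ℝ) (y : Quaternion ℝ) := by
  apply le_antisymm
  · refine Submodule.span_le.2 ?_
    rintro v ⟨c, h1, h2, h3, h4⟩
    have hd := hasDerivAt_of_contDiffAt h1 h4
    refine mem_levelTangent.2 ⟨?_, ?_, ?_⟩
    · refine velocity_fst_mem (α₁ := α₁) (α₂ := α₂) (X := (x, y)) ?_ (by rw [h3]; rfl) hd.fst
      filter_upwards [h2] with t ⟨Z, hZ, hZt⟩
      exact ⟨Z.1, hZ.1, by rw [← hZt]; rfl⟩
    · refine velocity_fst_mem (α₁ := α₁) (α₂ := α₂) (X := (x, y)) ?_ (by rw [h3]; rfl) hd.snd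
      filter_upwards [h2] with t ⟨Z, hZ, hZt⟩
      exact ⟨Z.2, hZ.2.1, by rw [← hZt]; rfl⟩
    · have a1 : HasDerivAt (fun t => (c t).1.1) v.1.1 0 := hd.fst.fst
      have a2 : HasDerivAt (fun t => (c t).1.2) v.1.2 0 := hd.fst.snd
      have b1 : HasDerivAt (fun t => (c t).2.1) v.2.1 0 := hd.snd.fst
      have b2 : HasDerivAt (fun t => (c t).2.2) v.2.2 0 := hd.snd.snd
      have e1 := a1.mul a2
      have e2 := b1.mul b2
      rw [h3] at e1 e2
      refine e1.unique (e2.congr_of_eventuallyEq ?_)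
      filter_upwards [h2] with t ⟨Z, hZ, hZt⟩
      rw [Pi.mul_apply, Pi.mul_apply, ← hZt]
      exact congrArg Subtype.val hZ.2.2
  · have hκ : twist (x : Quaternion ℝ) (y : Quaternion ℝ) ℓ ≠ 0 :=
      div_ne_zero (neg_ne_zero.2 (Int.cast_ne_zero.2 hℓ)) (one_sub_re_sq_pos x.2 y.2 hc).ne'
    rw [← graphTangent_sup x.2 y.2 hc hκ, ← tangentQuad_Lam hX hc, ← tangentQuad_Gam hX hc h]
    refine sup_le (tangentSpace_mono (Set.image_mono ?_) _)
      (tangentSpace_mono (Set.image_mono (Gam_subset_H ℓ)) _)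
    rw [Lam_eq_Gam]
    exact Gam_subset_H 0

end Points

/-! ### Orientations and local signs at a fixed point -/

section Signs

variable {α₁ α₂ : ℝ}

theorem conj_mem_Lam {g : SU2} {q : Quad} (hq : q ∈ Lam α₁ α₂) : conj g q ∈ Lam α₁ α₂ := by
  obtain ⟨⟨h1, h2⟩, h3⟩ := hq
  exact ⟨⟨conj_mem_conjClass h1, conj_mem_conjClass h2⟩, by simp [conj, h3]⟩

theorem conj_mem_Gam {ℓ : ℤ} {g : SU2} {q : Quad} (hq : q ∈ Gam α₁ α₂ (sigmaOne ^ (2 * ℓ))) :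
    conj g q ∈ Gam α₁ α₂ (sigmaOne ^ (2 * ℓ)) := by
  obtain ⟨⟨h1, h2⟩, h3⟩ := hq
  refine ⟨⟨conj_mem_conjClass h1, conj_mem_conjClass h2⟩, ?_⟩
  rw [sigmaOne_zpow_apply] at h3 ⊢
  simp only [conj, h3]
  have e : g * q.1.1 * g⁻¹ * (g * q.1.2 * g⁻¹) = g * (q.1.1 * q.1.2) * g⁻¹ := by group
  rw [e, conj_zpow]
  ext1 <;> simp only [mul_assoc, mul_inv_rev, inv_inv, inv_mul_cancel_left]

theorem cross_pos_of_ne {x y : SU2} (h : x * y ≠ y * x) :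
    0 < dot (cross (x : Quaternion ℝ) (y : Quaternion ℝ))
      (cross (x : Quaternion ℝ) (y : Quaternion ℝ)) := by
  refine (dot_self_nonneg _).lt_of_ne' fun h0 => h ?_
  have h1 := eq_zero_of_dot_self rfl h0
  have h2 : (x : Quaternion ℝ) * y - y * x = (2 : ℝ) • cross (x : Quaternion ℝ) y := by
    refine Quaternion.ext _ _ ?_ ?_ ?_ ?_ <;> simp <;> ring
  rw [h1, smul_zero, sub_eq_zero] at h2
  exact Subtype.ext h2

/-- Representatives of the intersection points are fixed points of the braid. -/
theorem exists_fixed_of_mem_inter {ℓ : ℤ} {z : HHat α₁ α₂}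
    (hz : z ∈ GamHat α₁ α₂ (sigmaOne ^ (2 * ℓ)) ∩ LamHat α₁ α₂) {p : HIrr α₁ α₂}
    (hp : toHHat p = z) : ∃ x y : SU2, p.1 = ((x, y), (x, y)) ∧ (x, y) ∈ R α₁ α₂ ∧
      (sigmaOne ^ (2 * ℓ)) (x, y) = (x, y) ∧
      0 < dot (cross (x : Quaternion ℝ) (y : Quaternion ℝ))
        (cross (x : Quaternion ℝ) (y : Quaternion ℝ)) := by
  obtain ⟨⟨q, hq, hqz⟩, ⟨r, hr, hrz⟩⟩ := hz
  obtain ⟨g, hg⟩ : ∃ g, conj g q.1 = p.1 := Quotient.exact (hqz.trans hp.symm)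
  obtain ⟨k, hk⟩ : ∃ g, conj g r.1 = p.1 := Quotient.exact (hrz.trans hp.symm)
  -- Both spaces are conjugation invariant, so `p` itself lies in `Γ_β` and in `Λ₂`.
  have hG := conj_mem_Gam (g := g) hq
  have hL := conj_mem_Lam (g := k) hr
  rw [hg] at hG
  rw [hk] at hL
  have hirr := p.2.2
  obtain ⟨⟨⟨x, y⟩, Y⟩, hp2⟩ := p
  obtain ⟨h1, h2⟩ := hL
  obtain ⟨-, h3⟩ := hG
  simp only at h1 h2 h3 hirr ⊢
  subst h2
  refine ⟨x, y, rfl, h1, h3.symm, cross_pos_of_ne fun hxy => hirr ?_⟩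
  intro a ha b hb
  simp only [Set.mem_insert_iff, Set.mem_singleton_iff] at ha hb
  rcases ha with rfl | rfl | rfl | rfl <;> rcases hb with rfl | rfl | rfl | rfl <;>
    first | rfl | exact hxy | exact hxy.symm

theorem fderiv_f_apply (x y : SU2) (w : Amb) :
    fderiv ℝ f (emb ((x, y), (x, y))) w = ratioDeriv (x : Quaternion ℝ) (y : Quaternion ℝ) w := by
  set z : Amb := emb ((x, y), (x, y)) with hz
  have hdiff : DifferentiableAt ℝ f z := by
    have h1 : DifferentiableAt ℝ (fun z : Amb => z.1.1) z := by fun_prop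
    have h2 : DifferentiableAt ℝ (fun z : Amb => z.1.2) z := by fun_prop
    have h3 : DifferentiableAt ℝ (fun z : Amb => z.2.1) z := by fun_prop
    have h4 : DifferentiableAt ℝ (fun z : Amb => z.2.2) z := by fun_prop
    exact (h1.mul h2).mul (h3.mul h4).star
  have hline : HasDerivAt (fun t : ℝ => z + t • w) w 0 := by
    have := ((hasDerivAt_id (0 : ℝ)).smul_const w).const_add z
    exact HasDerivAt.congr_deriv this (by simp)
  have a1 : HasDerivAt (fun t : ℝ => (z + t • w).1.1) w.1.1 0 := hline.fst.fst
  have a2 : HasDerivAt (fun t : ℝ => (z + t • w).1.2) w.1.2 0 := hline.fst.snd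
  have b1 : HasDerivAt (fun t : ℝ => (z + t • w).2.1) w.2.1 0 := hline.snd.fst
  have b2 : HasDerivAt (fun t : ℝ => (z + t • w).2.2) w.2.2 0 := hline.snd.snd
  have hz0 : z + (0 : ℝ) • w = z := by rw [zero_smul, add_zero]
  have h1 : HasDerivAt (fun t : ℝ => f (z + t • w)) (ratioDeriv (x : Quaternion ℝ) y w) 0 := by
    have := (a1.mul a2).mul (b1.mul b2).star
    refine HasDerivAt.congr_deriv this ?_
    simp only [Pi.mul_apply, hz0]
    rfl
  have h2 : HasDerivAt (fun t : ℝ => f (z + t • w)) (fderiv ℝ f z w) 0 := by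
    refine HasFDerivAt.comp_hasDerivAt (l := f) (0 : ℝ) ?_ hline
    rw [hz0]
    exact hdiff.hasFDerivAt
  exact h2.unique h1

variable {x y : SU2}

theorem R_orients (hX : (x, y) ∈ R α₁ α₂)
    (hc : 0 < dot (cross (x : Quaternion ℝ) (y : Quaternion ℝ))
      (cross (x : Quaternion ℝ) (y : Quaternion ℝ))) :
    Orients (pairTangent (x : Quaternion ℝ) (y : Quaternion ℝ))
      (pairFrame (x : Quaternion ℝ) (y : Quaternion ℝ)) (RPositive α₁ α₂ (x, y)) := by
  have h := pair_orients hc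
  rw [← tangentSpace_conjClass hX.1 (dot_self_pos_left hc),
    ← tangentSpace_conjClass hX.2 (dot_self_pos_right hc)] at h
  exact h

theorem RR_orients (hX : (x, y) ∈ R α₁ α₂)
    (hc : 0 < dot (cross (x : Quaternion ℝ) (y : Quaternion ℝ))
      (cross (x : Quaternion ℝ) (y : Quaternion ℝ))) :
    Orients ((pairTangent (x : Quaternion ℝ) (y : Quaternion ℝ)).prod
      (pairTangent (x : Quaternion ℝ) (y : Quaternion ℝ)))
      (quadFrame (x : Quaternion ℝ) (y : Quaternion ℝ))
      (RRPositive α₁ α₂ ((x, y), (x, y))) :=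
  (R_orients hX hc).prod (R_orients hX hc)

theorem HPositive_iff {ℓ : ℤ} (hℓ : ℓ ≠ 0) (hX : (x, y) ∈ R α₁ α₂)
    (hc : 0 < dot (cross (x : Quaternion ℝ) (y : Quaternion ℝ))
      (cross (x : Quaternion ℝ) (y : Quaternion ℝ)))
    (h : (sigmaOne ^ (2 * ℓ)) (x, y) = (x, y)) (e : Fin 5 → Amb) :
    HPositive α₁ α₂ ((x, y), (x, y)) e ↔
      LevelPositive (x : Quaternion ℝ) (y : Quaternion ℝ) e := by
  unfold HPositive LevelPositive
  rw [tangentQuad_H hℓ hX hc h]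
  simp only [fderiv_f_apply, (RR_orients hX hc).2]

theorem mkQ_eq_iff {e e' : Amb} : (orbitTangent ((x, y), (x, y))).mkQ e =
    (orbitTangent ((x, y), (x, y))).mkQ e' ↔ e - e' ∈
      Submodule.span ℝ (Set.range (diagOrbitFrame (x : Quaternion ℝ) (y : Quaternion ℝ))) :=
  Submodule.Quotient.eq _

/-- A tangent vector of a graph is determined by its first half, so the frame condition upstairs
follows from the one in `R₂`. -/
theorem GraphPositive_iff (hX : (x, y) ∈ R α₁ α₂)
    (hc : 0 < dot (cross (x : Quaternion ℝ) (y : Quaternion ℝ))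
      (cross (x : Quaternion ℝ) (y : Quaternion ℝ))) {S : Set Quad} {κ : ℝ}
    (hS : tangentQuad S ((x, y), (x, y)) = graphTangent (x : Quaternion ℝ) (y : Quaternion ℝ) κ)
    (e : Amb) :
    GraphPositive α₁ α₂ S ((x, y), (x, y)) (Fin.append ![e] (orbitFrame ((x, y), (x, y)))) ↔
      e ∈ graphTangent (x : Quaternion ℝ) (y : Quaternion ℝ) κ ∧
        SameOrientation (pairFrame (x : Quaternion ℝ) (y : Quaternion ℝ))
          (Fin.append ![e.1] (pairOrbitFrame (x : Quaternion ℝ) (y : Quaternion ℝ))) := by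
  unfold GraphPositive
  rw [hS, (R_orients hX hc).2]
  have he : (fun i => (Fin.append ![e] (orbitFrame ((x, y), (x, y))) i).1) =
      Fin.append ![e.1] (pairOrbitFrame (x : Quaternion ℝ) (y : Quaternion ℝ)) := by
    funext i
    refine Fin.addCases (fun j => ?_) (fun j => ?_) i
    · simp
    · simp only [Fin.append_right]
      rfl
  rw [he]
  constructor
  · rintro ⟨h1, h2⟩
    refine ⟨?_, h2⟩
    have := h1.mem (Fin.castAdd 3 0)
    rwa [Fin.append_left] at this
  · rintro ⟨h1, h2⟩
    refine ⟨?_, h2⟩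
    have := (graph_frame_iff κ).2 (h2.isFrame (R_orients hX hc).1)
    rw [← eq_graphMap_of_mem h1] at this
    exact this

theorem HatPositive_graph (hX : (x, y) ∈ R α₁ α₂)
    (hc : 0 < dot (cross (x : Quaternion ℝ) (y : Quaternion ℝ))
      (cross (x : Quaternion ℝ) (y : Quaternion ℝ))) {S : Set Quad} {κ : ℝ}
    (hS : tangentQuad S ((x, y), (x, y)) = graphTangent (x : Quaternion ℝ) (y : Quaternion ℝ) κ) :
    HatPositive (k := 1) ((x, y), (x, y)) (GraphPositive α₁ α₂ S ((x, y), (x, y)))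
      ![(orbitTangent ((x, y), (x, y))).mkQ
        (graphMap (x : Quaternion ℝ) (y : Quaternion ℝ) κ
          (slice (x : Quaternion ℝ) (y : Quaternion ℝ)))] := by
  refine ⟨![graphMap (x : Quaternion ℝ) (y : Quaternion ℝ) κ
    (slice (x : Quaternion ℝ) (y : Quaternion ℝ))], fun i => ?_, ?_⟩
  · fin_cases i; rfl
  · exact (GraphPositive_iff hX hc hS _).2
      ⟨⟨_, slice_mem _ _, rfl⟩, sameOrientation_slice hc⟩

/-- The oriented tangent line of the quotient curve is one ray: any lift of a positive vector is,
modulo the orbit, a positive multiple of the standard one. -/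
theorem exists_pos_of_HatPositive_graph (hX : (x, y) ∈ R α₁ α₂)
    (hc : 0 < dot (cross (x : Quaternion ℝ) (y : Quaternion ℝ))
      (cross (x : Quaternion ℝ) (y : Quaternion ℝ))) {S : Set Quad} {κ : ℝ}
    (hS : tangentQuad S ((x, y), (x, y)) = graphTangent (x : Quaternion ℝ) (y : Quaternion ℝ) κ)
    {u : Amb ⧸ orbitTangent ((x, y), (x, y))}
    (hu : HatPositive (k := 1) ((x, y), (x, y)) (GraphPositive α₁ α₂ S ((x, y), (x, y))) ![u])
    {e' : Amb} (he' : (orbitTangent ((x, y), (x, y))).mkQ e' = u) :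
    ∃ r : ℝ, 0 < r ∧ e' - r • graphMap (x : Quaternion ℝ) (y : Quaternion ℝ) κ
      (slice (x : Quaternion ℝ) (y : Quaternion ℝ)) ∈
      Submodule.span ℝ (Set.range (diagOrbitFrame (x : Quaternion ℝ) (y : Quaternion ℝ))) := by
  obtain ⟨e, h1, h2⟩ := hu
  have he : e = ![e 0] := by
    funext i
    rw [Subsingleton.elim i 0]
    rfl
  rw [he] at h2
  obtain ⟨h3, h4⟩ := (GraphPositive_iff hX hc hS _).1 h2
  obtain ⟨r, hr, h5⟩ := exists_pos_of_graph hc h3 h4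
  refine ⟨r, hr, ?_⟩
  have h6 := mkQ_eq_iff.1 (he'.trans (h1 0).symm)
  have := add_mem h6 h5
  rwa [sub_add_sub_cancel] at this

/-- With `κ = -ℓ / (1 - τ²)` the two minus signs cancel. -/
theorem hasDet_levelFrame (ℓ : ℤ)
    (hc : 0 < dot (cross (x : Quaternion ℝ) (y : Quaternion ℝ))
      (cross (x : Quaternion ℝ) (y : Quaternion ℝ))) :
    ∃ d : ℝ, 0 < d ∧ HasDet (quadFrame (x : Quaternion ℝ) (y : Quaternion ℝ))
      (Fin.append (normalFrame (x : Quaternion ℝ) (y : Quaternion ℝ))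
        (levelFrame (x : Quaternion ℝ) (y : Quaternion ℝ)
          (twist (x : Quaternion ℝ) (y : Quaternion ℝ) ℓ))) (ℓ * d) := by
  obtain ⟨r, hr, h⟩ := exists_hasDet_levelFrame hc
    (twist (x : Quaternion ℝ) (y : Quaternion ℝ) ℓ)
  have h1 := one_sub_re_sq_pos x.2 y.2 hc
  refine ⟨(1 - ((x : Quaternion ℝ) * y).re ^ 2)⁻¹ * r, by positivity, ?_⟩
  convert h using 1
  rw [twist]
  ring

end Signs

/-! ### Transversality and the sign of `ℓ` -/

section Conclusion

variable {α₁ α₂ : ℝ} {x y : SU2} {ℓ : ℤ}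

theorem tangentHat_sup (hℓ : ℓ ≠ 0) (hX : (x, y) ∈ R α₁ α₂)
    (hc : 0 < dot (cross (x : Quaternion ℝ) (y : Quaternion ℝ))
      (cross (x : Quaternion ℝ) (y : Quaternion ℝ)))
    (h : (sigmaOne ^ (2 * ℓ)) (x, y) = (x, y)) :
    tangentHat (Lam α₁ α₂) ((x, y), (x, y)) ⊔
      tangentHat (Gam α₁ α₂ (sigmaOne ^ (2 * ℓ))) ((x, y), (x, y)) =
        tangentHat (H α₁ α₂) ((x, y), (x, y)) := by
  have hκ : twist (x : Quaternion ℝ) (y : Quaternion ℝ) ℓ ≠ 0 :=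
    div_ne_zero (neg_ne_zero.2 (Int.cast_ne_zero.2 hℓ)) (one_sub_re_sq_pos x.2 y.2 hc).ne'
  unfold tangentHat
  rw [← Submodule.map_sup, tangentQuad_Lam hX hc, tangentQuad_Gam hX hc h,
    tangentQuad_H hℓ hX hc h, graphTangent_sup x.2 y.2 hc hκ]

/-- The classes of the standard tangent vectors are positive. -/
theorem positiveTangents (hX : (x, y) ∈ R α₁ α₂)
    (hc : 0 < dot (cross (x : Quaternion ℝ) (y : Quaternion ℝ))
      (cross (x : Quaternion ℝ) (y : Quaternion ℝ)))
    (h : (sigmaOne ^ (2 * ℓ)) (x, y) = (x, y)) :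
    PositiveTangents α₁ α₂ (sigmaOne ^ (2 * ℓ)) ((x, y), (x, y))
      ((orbitTangent ((x, y), (x, y))).mkQ (graphMap (x : Quaternion ℝ) (y : Quaternion ℝ) 0
        (slice (x : Quaternion ℝ) (y : Quaternion ℝ))))
      ((orbitTangent ((x, y), (x, y))).mkQ (graphMap (x : Quaternion ℝ) (y : Quaternion ℝ)
        (twist (x : Quaternion ℝ) (y : Quaternion ℝ) ℓ)
        (slice (x : Quaternion ℝ) (y : Quaternion ℝ)))) :=
  ⟨HatPositive_graph hX hc (tangentQuad_Lam hX hc),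
    HatPositive_graph hX hc (tangentQuad_Gam hX hc h)⟩

/-- For `ℓ > 0` the positive tangent vectors form a positive frame of the pillowcase. -/
theorem exists_positive_frame (hℓ : 0 < ℓ) (hX : (x, y) ∈ R α₁ α₂)
    (hc : 0 < dot (cross (x : Quaternion ℝ) (y : Quaternion ℝ))
      (cross (x : Quaternion ℝ) (y : Quaternion ℝ)))
    (h : (sigmaOne ^ (2 * ℓ)) (x, y) = (x, y)) :
    ∃ u v, PositiveTangents α₁ α₂ (sigmaOne ^ (2 * ℓ)) ((x, y), (x, y)) u v ∧
      HatPositive (k := 2) ((x, y), (x, y)) (HPositive α₁ α₂ ((x, y), (x, y))) ![u, v] := by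
  have hκ : twist (x : Quaternion ℝ) (y : Quaternion ℝ) ℓ ≠ 0 :=
    div_ne_zero (neg_ne_zero.2 (Int.cast_ne_zero.2 hℓ.ne')) (one_sub_re_sq_pos x.2 y.2 hc).ne'
  obtain ⟨d, hd, hdet⟩ := hasDet_levelFrame ℓ hc
  refine ⟨_, _, positiveTangents hX hc h, ![_, _], fun i => ?_,
    (HPositive_iff hℓ.ne' hX hc h _).2 (levelPositive_of_hasDet x.2 y.2 hc
      (levelFrame_isFrame x.2 y.2 hc hκ) hdet (mul_pos (Int.cast_pos.2 hℓ) hd))⟩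
  fin_cases i <;> rfl

/-- For `ℓ < 0` the positive tangent vectors form a negative frame of the pillowcase. -/
theorem exists_negative_frame (hℓ : ℓ < 0) (hX : (x, y) ∈ R α₁ α₂)
    (hc : 0 < dot (cross (x : Quaternion ℝ) (y : Quaternion ℝ))
      (cross (x : Quaternion ℝ) (y : Quaternion ℝ)))
    (h : (sigmaOne ^ (2 * ℓ)) (x, y) = (x, y)) :
    ∃ u v, PositiveTangents α₁ α₂ (sigmaOne ^ (2 * ℓ)) ((x, y), (x, y)) u v ∧
      HatPositive (k := 2) ((x, y), (x, y)) (HPositive α₁ α₂ ((x, y), (x, y))) ![v, u] := by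
  have hκ : twist (x : Quaternion ℝ) (y : Quaternion ℝ) ℓ ≠ 0 :=
    div_ne_zero (neg_ne_zero.2 (Int.cast_ne_zero.2 hℓ.ne)) (one_sub_re_sq_pos x.2 y.2 hc).ne'
  obtain ⟨d, hd, hdet⟩ := hasDet_levelFrame ℓ hc
  have hswap := hasDet_swap (x : Quaternion ℝ) (y : Quaternion ℝ)
    (twist (x : Quaternion ℝ) (y : Quaternion ℝ) ℓ)
  have hneg : (ℓ : ℝ) < 0 := Int.cast_lt_zero.2 hℓ
  refine ⟨_, _, positiveTangents hX hc h, ![_, _], fun i => ?_,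
    (HPositive_iff hℓ.ne hX hc h _).2 (levelPositive_of_hasDet x.2 y.2 hc
      (hswap.isFrame (by norm_num) (levelFrame_isFrame x.2 y.2 hc hκ))
      (hdet.trans (hswap.append_left _)) (by nlinarith [mul_neg_of_neg_of_pos hneg hd]))⟩
  fin_cases i <;> rfl

/-- For `ℓ < 0` no positive tangent vectors form a positive frame of the pillowcase. -/
theorem not_positive_frame (hℓ : ℓ < 0) (hX : (x, y) ∈ R α₁ α₂)
    (hc : 0 < dot (cross (x : Quaternion ℝ) (y : Quaternion ℝ))
      (cross (x : Quaternion ℝ) (y : Quaternion ℝ)))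
    (h : (sigmaOne ^ (2 * ℓ)) (x, y) = (x, y)) :
    ¬ ∃ u v, PositiveTangents α₁ α₂ (sigmaOne ^ (2 * ℓ)) ((x, y), (x, y)) u v ∧
      HatPositive (k := 2) ((x, y), (x, y)) (HPositive α₁ α₂ ((x, y), (x, y))) ![u, v] := by
  rintro ⟨u, v, ⟨hu, hv⟩, e, he, hpos⟩
  have hκ : twist (x : Quaternion ℝ) (y : Quaternion ℝ) ℓ ≠ 0 :=
    div_ne_zero (neg_ne_zero.2 (Int.cast_ne_zero.2 hℓ.ne)) (one_sub_re_sq_pos x.2 y.2 hc).ne'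
  obtain ⟨d, hd, hdet⟩ := hasDet_levelFrame ℓ hc
  obtain ⟨r, hr, h1⟩ := exists_pos_of_HatPositive_graph hX hc (tangentQuad_Lam hX hc) hu (he 0)
  obtain ⟨s, hs, h2⟩ := exists_pos_of_HatPositive_graph hX hc (tangentQuad_Gam hX hc h) hv (he 1)
  have hee : e = ![e 0, e 1] := by
    funext i
    fin_cases i <;> rfl
  rw [hee] at hpos
  have h3 := pos_of_levelPositive x.2 y.2 hc (levelFrame_isFrame x.2 y.2 hc hκ)
    (sameOrientation_of_mod_orbit hr hs h1 h2) hdet ((HPositive_iff hℓ.ne hX hc h _).1 hpos)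
  have h4 : (ℓ : ℝ) < 0 := Int.cast_lt_zero.2 hℓ
  exact absurd h3 (mul_neg_of_neg_of_pos h4 hd).not_gt

end Conclusion

end Pillowcase

end

theorem proposition5p5 (α₁ α₂ : ℝ) (hα₁ : α₁ ∈ Set.Ioo 0 Real.pi) (hα₂ : α₂ ∈ Set.Ioo 0 Real.pi)
    (ℓ : ℤ) (hℓ : ℓ ≠ 0) :
    (∀ x ∈ Pillowcase.GamHat α₁ α₂ (Pillowcase.sigmaOne ^ (2 * ℓ)) ∩ Pillowcase.LamHat α₁ α₂,
      Pillowcase.TransverseAt (Pillowcase.sigmaOne ^ (2 * ℓ)) x) ∧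
    ∃ ε : ℤ, (ε = 1 ∨ ε = -1) ∧
      ∀ x ∈ Pillowcase.GamHat α₁ α₂ (Pillowcase.sigmaOne ^ (2 * ℓ)) ∩ Pillowcase.LamHat α₁ α₂,
        Pillowcase.localSign (Pillowcase.sigmaOne ^ (2 * ℓ)) x = ε := by
  constructor
  · intro z hz p hp
    obtain ⟨x, y, hpe, hX, hfix, hc⟩ := Pillowcase.exists_fixed_of_mem_inter hz hp
    rw [hpe]
    exact Pillowcase.tangentHat_sup hℓ hX hc hfix
  · rcases hℓ.lt_or_gt with hneg | hpos
    · refine ⟨-1, Or.inr rfl, fun z hz => ?_⟩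
      obtain ⟨p, hp⟩ : ∃ p, Pillowcase.toHHat p = z := Quotient.exists_rep z
      unfold Pillowcase.localSign
      -- `localSign` tests the value `1` first and over all representatives, so for `ℓ < 0` a
      -- positive frame must be excluded at each of them.
      rw [if_neg, if_pos]
      · refine ⟨p, hp, ?_⟩
        obtain ⟨x, y, hpe, hX, hfix, hc⟩ := Pillowcase.exists_fixed_of_mem_inter hz hp
        rw [hpe]
        exact Pillowcase.exists_negative_frame hneg hX hc hfix
      · rintro ⟨q, hq, h⟩
        obtain ⟨x, y, hqe, hX, hfix, hc⟩ := Pillowcase.exists_fixed_of_mem_inter hz hq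
        rw [hqe] at h
        exact Pillowcase.not_positive_frame hneg hX hc hfix h
    · refine ⟨1, Or.inl rfl, fun z hz => ?_⟩
      obtain ⟨p, hp⟩ : ∃ p, Pillowcase.toHHat p = z := Quotient.exists_rep z
      unfold Pillowcase.localSign
      rw [if_pos]
      refine ⟨p, hp, ?_⟩
      obtain ⟨x, y, hpe, hX, hfix, hc⟩ := Pillowcase.exists_fixed_of_mem_inter hz hp
      rw [hpe]
      exact Pillowcase.exists_positive_frame hpos hX hc hfix
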